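/- Let $M$ be a compact smooth manifold without boundary of dimension $2n$ (not necessarily orientable or connected). A bivector field $w\in\Gamma(\wedge^2TM)$ is Poisson if $\{f,g\}=w(df,dg)$ is a Lie bracket on $C^\infty(M)$; $\mathrm{Poiss}(M)$ denotes the set of Poisson structures with the $C^1$-topology. A Poisson structure $\pi$ is log symplectic if the section $\wedge^n\pi$ of $\wedge^{2n}TM$ is transverse to the zero section; its singular locus is $(\wedge^n\pi)^{-1}(0)$. For a closed embedded hypersurface $Z\subset M$, let $T_ZM$ be the b-tangent bundle, whose sections are the vector fields on $M$ tangent to $Z$; sections of $\wedge^2T_ZM$ are the bivector fields tangent to $Z$. Let $\mathrm{Log}(M,Z)\subset\Gamma(\wedge^2T_ZM)$ be the set of log symplectic structures on $M$ with singular locus exactly $Z$, with the topology induced by the $C^0$-topology on $\Gamma(\wedge^2T_ZM)$, i.e. uniform convergence of components with respect to local frames of $T_ZM$ (near $Z=\{t=0\}$, the frame $t\,\partial_t,\partial_{x_1},\dots,\partial_{x_{2n-1}}$). Let $\pi$ be a log symplectic structure on $M$ with singular locus $Z$. Then every Poisson structure sufficiently $C^1$-close to $\pi$ is log symplectic, with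 singular locus diffeomorphic to $Z$. More precisely, there are a $C^1$-open subset $\mathcal V\subset\mathrm{Poiss}(M)$ containing $\pi$ and a map $\Phi:\mathcal V\to\mathrm{Diff}(M)$ such that $\Phi(\pi)=\mathrm{id}_M$ and, for every $\pi'\in\mathcal V$, $\pi'$ is log symplectic, $\Phi(\pi')$ maps its singular locus onto $Z$, and $\Phi(\pi')_*(\pi')\in\mathrm{Log}(M,Z)$. Moreover, the map $$\Psi:\mathcal V\to\mathrm{Log}(M,Z),\qquad \Psi(\pi')=\Phi(\pi')_*(\pi'),$$ is continuous for the $C^1$-topology on $\mathcal V$ and the $C^0$-topology on $\mathrm{Log}(M,Z)$. -/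

import Mathlib

open scoped Manifold ContDiff Topology UniformConvergence

noncomputable section

namespace LogSymp

/-- The model space of a manifold of dimension `2n`. -/
abbrev Model (n : ℕ) : Type := EuclideanSpace ℝ (Fin (2 * n))

/-- The cotangent space `T*_x M`. -/
abbrev Cotangent (n : ℕ) {M : Type*} [TopologicalSpace M] [ChartedSpace (Model n) M] (x : M) :
    Type :=
  TangentSpace (𝓡 (2 * n)) x →L[ℝ] ℝ

/-- The differential `df_x ∈ T*_x M` of a real function `f`. -/
def differential (n : ℕ) {M : Type*} [TopologicalSpace M] [ChartedSpace (Model n) M]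
    (f : M → ℝ) (x : M) : Cotangent n x :=
  mvfderiv (𝓡 (2 * n)) f x

/-- The differential at `x` of the `j`-th coordinate function of a chart `e`. -/
def coordDifferential {n : ℕ} {M : Type*} [TopologicalSpace M] [ChartedSpace (Model n) M]
    (e : OpenPartialHomeomorph M (Model n)) (j : Fin (2 * n)) (x : M) : Cotangent n x :=
  differential n (fun x' => e x' j) x

/-- All charts of the smooth structure of `M`. -/
abbrev charts (n : ℕ) (M : Type*) [TopologicalSpace M] [ChartedSpace (Model n) M] :
    Set (OpenPartialHomeomorph M (Model n)) :=
  IsManifold.maximalAtlas (𝓡 (2 * n)) ∞ M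

/-- The component `w^{jk} = w(dy_j, dy_k)` in a chart `e` of a field `w` of bilinear forms on the
cotangent spaces, as a function of the coordinates `y` (meaningful on `e.target`). -/
def component {n : ℕ} {M : Type*} [TopologicalSpace M] [ChartedSpace (Model n) M]
    (w : ∀ x : M, LinearMap.BilinForm ℝ (Cotangent n x))
    (e : OpenPartialHomeomorph M (Model n)) (j k : Fin (2 * n)) (y : Model n) : ℝ :=
  w (e.symm y) (coordDifferential e j (e.symm y)) (coordDifferential e k (e.symm y))

/-- Smooth bivector fields on `M`, i.e. smooth sections of `⋀² TM`. An element of `⋀² T_x M` is an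
alternating bilinear form on `T*_x M`; smoothness means that the components in all charts are
smooth. -/
structure BivectorField (n : ℕ) (M : Type*) [TopologicalSpace M] [ChartedSpace (Model n) M] where
  toFun : ∀ x : M, LinearMap.BilinForm ℝ (Cotangent n x)
  isAlt : ∀ x, (toFun x).IsAlt
  smooth : ∀ e ∈ charts n M, ∀ j k, ContDiffOn ℝ ∞ (component toFun e j k) e.target

/-- Compact subsets of the image of a chart. -/
abbrev chartCompacts {n : ℕ} {M : Type*} [TopologicalSpace M]
    (e : OpenPartialHomeomorph M (Model n)) : Set (Set (Model n)) :=
  {K | IsCompact K ∧ K ⊆ e.target}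

/-- The `C¹`-topology on bivector fields: uniform convergence of the components and of their first
derivatives on the compact subsets of the image of every chart. -/
instance BivectorField.c1Topology (n : ℕ) (M : Type*) [TopologicalSpace M]
    [ChartedSpace (Model n) M] : TopologicalSpace (BivectorField n M) :=
  ⨅ (e ∈ charts n M) (j : Fin (2 * n)) (k : Fin (2 * n)),
    TopologicalSpace.induced
        (fun w : BivectorField n M =>
          UniformOnFun.ofFun (chartCompacts e) (component w.toFun e j k)) inferInstance ⊓
      TopologicalSpace.induced
        (fun w : BivectorField n M =>
          UniformOnFun.ofFun (chartCompacts e) (fderiv ℝ (component w.toFun e j k))) inferInstance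

/-- The bracket `{f, g} = w(df, dg)`. -/
def BivectorField.bracket {n : ℕ} {M : Type*} [TopologicalSpace M] [ChartedSpace (Model n) M]
    (w : BivectorField n M) (f g : M → ℝ) (x : M) : ℝ :=
  w.toFun x (differential n f x) (differential n g x)

/-- `w` is a Poisson structure: its bracket is a Lie bracket on `C^∞(M)`. Bilinearity, antisymmetry
and the Leibniz rule hold for every bivector field, so this is the Jacobi identity. -/
def BivectorField.IsPoisson {n : ℕ} {M : Type*} [TopologicalSpace M] [ChartedSpace (Model n) M]
    (w : BivectorField n M) : Prop :=
  ∀ f g h : C^∞⟮𝓡 (2 * n), M; ℝ⟯, ∀ x : M,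
    w.bracket f (w.bracket g h) x + w.bracket g (w.bracket h f) x
      + w.bracket h (w.bracket f g) x = 0

/-- The space of Poisson structures, with the topology induced by the `C¹`-topology. -/
abbrev Poiss (n : ℕ) (M : Type*) [TopologicalSpace M] [ChartedSpace (Model n) M] : Type _ :=
  {w : BivectorField n M // w.IsPoisson}

/-- The wedge power `⋀ⁿ w (x) ∈ ⋀^{2n} T_x M`, as an alternating `2n`-form on `T*_x M`:
`(α₁, …, α_{2n}) ↦ 2⁻ⁿ ∑_σ sgn σ ∏_k w(α_{σ(2k)}, α_{σ(2k+1)})`. -/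
def BivectorField.wedgePow {n : ℕ} {M : Type*} [TopologicalSpace M] [ChartedSpace (Model n) M]
    (w : BivectorField n M) (x : M) (α : Fin (2 * n) → Cotangent n x) : ℝ :=
  (1 / 2 ^ n) * ∑ σ : Equiv.Perm (Fin (2 * n)), ((Equiv.Perm.sign σ : ℤ) : ℝ) *
    ∏ k : Fin n, w.toFun x (α (σ ⟨2 * k, by omega⟩)) (α (σ ⟨2 * k + 1, by omega⟩))

/-- The section `⋀ⁿ w` of the line bundle `⋀^{2n} TM` in the trivialization
`s ↦ s(dy_1, …, dy_{2n})` over a chart `e`, as a function of the coordinates. -/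
def BivectorField.wedgePowComponent {n : ℕ} {M : Type*} [TopologicalSpace M]
    [ChartedSpace (Model n) M] (w : BivectorField n M)
    (e : OpenPartialHomeomorph M (Model n)) (y : Model n) : ℝ :=
  w.wedgePow (e.symm y) (fun j => coordDifferential e j (e.symm y))

/-- `⋀ⁿ w : M → ⋀^{2n} TM` is transverse to the zero section: in the local trivialization over each
chart, wherever the section `y ↦ (y, s(y))` meets the zero section, the image of its differential
and the tangent space `ℝ^{2n} × 0` of the zero section together span `ℝ^{2n} × ℝ`. -/
def BivectorField.WedgePowTransverse {n : ℕ} {M : Type*} [TopologicalSpace M]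
    [ChartedSpace (Model n) M] (w : BivectorField n M) : Prop :=
  ∀ e ∈ charts n M, ∀ y ∈ e.target, w.wedgePowComponent e y = 0 →
    LinearMap.range
        (fderiv ℝ (fun y' : Model n => (y', w.wedgePowComponent e y')) y :
          Model n →ₗ[ℝ] Model n × ℝ) ⊔
      Submodule.prod ⊤ ⊥ = ⊤

/-- Log symplectic structures. -/
def BivectorField.IsLogSymplectic {n : ℕ} {M : Type*} [TopologicalSpace M]
    [ChartedSpace (Model n) M] (w : BivectorField n M) : Prop :=
  w.IsPoisson ∧ w.WedgePowTransverse

/-- The singular locus `(⋀ⁿ w)⁻¹(0)`. -/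
def BivectorField.singularLocus {n : ℕ} {M : Type*} [TopologicalSpace M]
    [ChartedSpace (Model n) M] (w : BivectorField n M) : Set M :=
  {x | w.wedgePow x = 0}

/-- `e` is a chart in which `Z` is the coordinate hyperplane `{y_i = 0}`. -/
def IsAdapted {n : ℕ} {M : Type*} [TopologicalSpace M] [ChartedSpace (Model n) M]
    (Z : Set M) (e : OpenPartialHomeomorph M (Model n)) (i : Fin (2 * n)) : Prop :=
  e ∈ charts n M ∧ ∀ x ∈ e.source, x ∈ Z ↔ e x i = 0

/-- Smooth sections of `⋀² T_Z M` for a hypersurface `Z`: the bivector fields tangent to `Z`,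
i.e. lying in `⋀² TZ` along `Z`. In charts in which `Z = {y_i = 0}`, this says that the
components `w^{ij}` vanish on `{y_i = 0}`. -/
structure BBivectorField (n : ℕ) {M : Type*} [TopologicalSpace M] [ChartedSpace (Model n) M]
    (Z : Set M) extends BivectorField n M where
  tangent : ∀ e i, IsAdapted Z e i → ∀ j, ∀ y ∈ e.target, y i = 0 →
    component toFun e i j y = 0

/-- The quotient `f(y) / y_i`, continued to `{y_i = 0}` by `∂f/∂y_i`. If `f` is smooth and vanishes
on `{y_i = 0}`, this is the smooth function `g` with `f = y_i g`. -/
def divCoord {n : ℕ} (i : Fin (2 * n)) (f : Model n → ℝ) (y : Model n) : ℝ :=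
  if y i = 0 then fderiv ℝ f y (EuclideanSpace.single i 1) else f y / y i

/-- The components of a section of `⋀² T_Z M` in a chart in which `Z = {y_i = 0}`, with respect to
the frame of `T_Z M` that consists of `y_i ∂/∂y_i` and the `∂/∂y_j`, `j ≠ i`. -/
def bComponent {n : ℕ} {M : Type*} [TopologicalSpace M] [ChartedSpace (Model n) M]
    (w : ∀ x : M, LinearMap.BilinForm ℝ (Cotangent n x))
    (e : OpenPartialHomeomorph M (Model n)) (i j k : Fin (2 * n)) : Model n → ℝ :=
  if j = i ∨ k = i then divCoord i (component w e j k) else component w e j k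

/-- The `C⁰`-topology on sections of `⋀² T_Z M`: uniform convergence, on the compact subsets of the
image of the chart, of the components in the local frames of `T_Z M`, namely the coordinate frame
`∂/∂y_j` for charts disjoint from `Z`, and `y_i ∂/∂y_i`, `∂/∂y_j` (`j ≠ i`) for charts in which
`Z = {y_i = 0}`. -/
instance BBivectorField.c0Topology (n : ℕ) {M : Type*} [TopologicalSpace M]
    [ChartedSpace (Model n) M] (Z : Set M) : TopologicalSpace (BBivectorField n Z) :=
  (⨅ (e ∈ charts n M) (_ : Disjoint e.source Z) (j : Fin (2 * n)) (k : Fin (2 * n)),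
    TopologicalSpace.induced
      (fun w : BBivectorField n Z =>
        UniformOnFun.ofFun (chartCompacts e) (component w.toFun e j k)) inferInstance) ⊓
  ⨅ (e : OpenPartialHomeomorph M (Model n)) (i : Fin (2 * n)) (_ : IsAdapted Z e i)
      (j : Fin (2 * n)) (k : Fin (2 * n)),
    TopologicalSpace.induced
      (fun w : BBivectorField n Z =>
        UniformOnFun.ofFun (chartCompacts e) (bComponent w.toFun e i j k)) inferInstance

/-- `Log(M, Z)`: the log symplectic structures with singular locus exactly `Z`, with the topology
induced by the `C⁰`-topology on sections of `⋀² T_Z M`. -/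
abbrev Log (n : ℕ) {M : Type*} [TopologicalSpace M] [ChartedSpace (Model n) M] (Z : Set M) :
    Type _ :=
  {w : BBivectorField n Z //
    w.toBivectorField.IsLogSymplectic ∧ w.toBivectorField.singularLocus = Z}

/-- The group `Diff(M)` of smooth diffeomorphisms of `M`. -/
abbrev Diff (n : ℕ) (M : Type*) [TopologicalSpace M] [ChartedSpace (Model n) M] : Type _ :=
  Diffeomorph (𝓡 (2 * n)) (𝓡 (2 * n)) M M ∞

/-- `w' = φ_* w`, i.e. `w'_{φ(x)}(α, β) = w_x(φ^* α, φ^* β)`. As `φ` is bijective, this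
determines `w'`. -/
def IsPushforward {n : ℕ} {M : Type*} [TopologicalSpace M] [ChartedSpace (Model n) M]
    (φ : Diff n M) (w w' : BivectorField n M) : Prop :=
  ∀ (x : M) (α β : Cotangent n (φ x)),
    w'.toFun (φ x) α β =
      w.toFun x (α.comp (mfderiv (𝓡 (2 * n)) (𝓡 (2 * n)) φ x))
        (β.comp (mfderiv (𝓡 (2 * n)) (𝓡 (2 * n)) φ x))

end LogSymp

end

/-!
Fix the log symplectic structure `π` and let `π'` be a Poisson structure that is `C¹`-close to it.
Near a point of `Z`, the function `⋀ⁿ π` is one of the coordinates of a suitable chart. Moving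
points along this coordinate, cut off by bump functions, until it equals `⋀ⁿ π'` gives after
finitely many steps a map `Φ` that is `C¹`-close to the identity, hence a diffeomorphism, with
`⋀ⁿ π ∘ Φ = c ⋀ⁿ π'` for a nowhere vanishing factor `c` that is `C¹` and depends continuously on
`π'`. So `Φ` maps the singular locus of `π'` onto `Z`.

The continuity of `Φ_* π'` in the `C⁰`-topology on sections of `⋀² T_Z M` would seem to require a
second derivative of `π'`, because `Φ` is only `C¹`-controlled and the normal components have to be
divided by the equation of `Z`. The Jacobi identity avoids this: the Hamiltonian vector field of
`log |c ⋀ⁿ π'|` extends over the singular locus by a formula that contains only first derivatives of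
`π'` and `c`, and `Φ` carries it to the contraction of `Φ_* π'` with `d log |⋀ⁿ π|`.
-/

noncomputable section

namespace LogSymp

/-! ### The top wedge power and the Jacobi identity in coordinates -/

section Pfaffian

variable {n : ℕ}

/-- The matrix counterpart of `⋀ⁿ w`: the coefficient of `∂₁ ∧ ⋯ ∧ ∂₂ₙ` in the `n`-th wedge power of
the bivector with matrix `W`, which is `n!` times the Pfaffian of `W`. -/
def scaledPfaffian {K : Type*} [Field K] (W : Matrix (Fin (2 * n)) (Fin (2 * n)) K) : K :=
  (1 / 2 ^ n) * ∑ σ : Equiv.Perm (Fin (2 * n)), ((Equiv.Perm.sign σ : ℤ) : K) *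
    ∏ k : Fin n, W (σ ⟨2 * k, by omega⟩) (σ ⟨2 * k + 1, by omega⟩)

/-- The multilinear map `α ↦ ∏ₖ B(α_{2k}, α_{2k+1})`, whose alternatization is the `n`-th wedge
power of an alternating form `B` up to a constant factor. -/
def pairProd {R N : Type*} [CommRing R] [AddCommGroup N] [Module R N]
    (B : LinearMap.BilinForm R N) : MultilinearMap R (fun _ : Fin (2 * n) => N) R :=
  ((MultilinearMap.mkPiAlgebra R (Fin n) R).compMultilinearMap fun _ =>
    LinearMap.uncurryLeft (n := 1) (M := fun _ => N)
      ((MultilinearMap.ofSubsingletonₗ R R N R (0 : Fin 1)).toLinearMap ∘ₗ B)).domDomCongr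
    ((Equiv.sigmaEquivProd (Fin n) (Fin 2)).trans
      (finProdFinEquiv.trans (finCongr (mul_comm n 2))))

theorem pairProd_apply {R N : Type*} [CommRing R] [AddCommGroup N] [Module R N]
    (B : LinearMap.BilinForm R N) (α : Fin (2 * n) → N) :
    pairProd B α = ∏ k : Fin n, B (α ⟨2 * k, by omega⟩) (α ⟨2 * k + 1, by omega⟩) := by
  simp only [pairProd, MultilinearMap.domDomCongr_apply,
    MultilinearMap.compMultilinearMap_apply, MultilinearMap.mkPiAlgebra_apply]
  refine Finset.prod_congr rfl fun k _ => ?_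
  have hindex (j : Fin 2) : finCongr (mul_comm n 2) (finProdFinEquiv (k, j)) =
      ⟨2 * k + j, by omega⟩ := Fin.ext (add_comm _ _)
  exact congrArg₂ (fun a b => B (α a) (α b)) (hindex 0) (hindex 1)

theorem scaledPfaffian_mul_mul_transpose {K : Type*} [Field K]
    (A W : Matrix (Fin (2 * n)) (Fin (2 * n)) K) :
    scaledPfaffian (A * W * A.transpose) = A.det * scaledPfaffian W := by
  let f : (Fin (2 * n) → K) [⋀^Fin (2 * n)]→ₗ[K] K :=
    (1 / 2 ^ n : K) • MultilinearMap.alternatization (pairProd (Matrix.toBilin' W))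
  have scaledPfaffian_conj (C : Matrix (Fin (2 * n)) (Fin (2 * n)) K) :
      scaledPfaffian (C * W * C.transpose) = f (Matrix.of.symm C) := by
    have hC (i j) : (C * W * C.transpose) i j =
        Matrix.toBilin' W (Matrix.of.symm C i) (Matrix.of.symm C j) := by
      rw [Matrix.toBilin'_apply', Matrix.dotProduct_mulVec]
      rfl
    simp only [f, scaledPfaffian, hC, AlternatingMap.smul_apply, smul_eq_mul,
      MultilinearMap.alternatization_apply, Units.smul_def, zsmul_eq_mul,
      MultilinearMap.domDomCongr_apply, pairProd_apply]
  have f_eq : f (Matrix.of.symm A) = f (Matrix.of.symm 1) * A.det := by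
    have h := congrArg (· (Matrix.of.symm A)) (f.eq_smul_basis_det (Pi.basisFun K (Fin (2 * n))))
    have hone : ⇑(Pi.basisFun K (Fin (2 * n))) = Matrix.of.symm 1 := by
      ext i j
      simp [Matrix.one_apply, Pi.single_apply, eq_comm]
    simpa only [AlternatingMap.smul_apply, smul_eq_mul, Pi.basisFun_det_apply, hone,
      Equiv.apply_symm_apply] using h
  rw [scaledPfaffian_conj, f_eq, ← scaledPfaffian_conj, one_mul, Matrix.transpose_one, mul_one,
    mul_comm]

variable {𝕜 : Type*} [NontriviallyNormedField 𝕜]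

theorem contDiff_scaledPfaffian {m : WithTop ℕ∞} : ContDiff 𝕜 m
    (fun W : Fin (2 * n) → Fin (2 * n) → 𝕜 => scaledPfaffian (Matrix.of W)) := by
  simp only [scaledPfaffian, Matrix.of_apply]
  fun_prop

theorem hasDerivAt_det_one_add_smul {ι : Type*} [Fintype ι] [DecidableEq ι] (B : Matrix ι ι 𝕜) :
    HasDerivAt (fun t : 𝕜 => (1 + t • B).det) B.trace 0 := by
  have h := (1 + (Polynomial.X : Polynomial 𝕜) • B.map Polynomial.C).det.hasDerivAt 0
  rw [Matrix.derivative_det_one_add_X_smul] at h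
  refine h.congr_of_eventuallyEq (.of_forall fun t => ?_)
  dsimp only
  rw [← Polynomial.coe_evalRingHom, RingHom.map_det]
  congr 1
  ext i j
  rcases eq_or_ne i j with rfl | hij
  · simp [mul_comm (B i i)]
  · simp [hij, mul_comm (B i j)]

theorem hasDerivAt_conj {ι : Type*} [Fintype ι] [DecidableEq ι] (B W : Matrix ι ι 𝕜) :
    HasDerivAt (fun t : 𝕜 => Matrix.of.symm ((1 + t • B) * W * (1 + t • B).transpose))
      (Matrix.of.symm (B * W + W * B.transpose)) 0 := by
  have hexpand (t : 𝕜) : (1 + t • B) * W * (1 + t • B).transpose =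
      W + t • (B * W + W * B.transpose) + t ^ 2 • (B * W * B.transpose) := by
    simp only [Matrix.transpose_add, Matrix.transpose_one, Matrix.transpose_smul, Matrix.add_mul,
      Matrix.mul_add, one_mul, mul_one, Matrix.smul_mul, Matrix.mul_smul]
    module
  refine hasDerivAt_pi.2 fun a => hasDerivAt_pi.2 fun b => ?_
  have h := (((hasDerivAt_id (0 : 𝕜)).mul_const ((B * W + W * B.transpose) a b)).const_add
    (W a b)).fun_add ((hasDerivAt_pow 2 (0 : 𝕜)).mul_const ((B * W * B.transpose) a b))
  refine (h.congr_of_eventuallyEq (.of_forall fun t => ?_)).congr_deriv ?_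
  · exact congrFun₂ (hexpand t) a b
  · simp only [one_mul, Nat.add_one_sub_one, pow_one, mul_zero, zero_mul, add_zero,
      Matrix.of_symm_apply]

theorem fderiv_scaledPfaffian_apply (B W : Matrix (Fin (2 * n)) (Fin (2 * n)) 𝕜) :
    fderiv 𝕜 (fun W : Fin (2 * n) → Fin (2 * n) → 𝕜 => scaledPfaffian (Matrix.of W))
      (Matrix.of.symm W) (Matrix.of.symm (B * W + W * B.transpose)) =
        B.trace * scaledPfaffian W := by
  have hPf := (contDiff_scaledPfaffian (𝕜 := 𝕜) (n := n) (m := 1)).differentiable one_ne_zero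
    (Matrix.of.symm W)
  have h := hPf.hasFDerivAt.comp_hasDerivAt_of_eq (0 : 𝕜) (hasDerivAt_conj B W) (by simp)
  refine h.unique (((hasDerivAt_det_one_add_smul B).mul_const
    (scaledPfaffian W)).congr_of_eventuallyEq (.of_forall fun t => ?_))
  exact scaledPfaffian_mul_mul_transpose _ _

/-- The infinitesimal covariance of the Pfaffian turns the Jacobi identity, whose three cyclic terms
contracted with `∂Pf/∂W` are `∂_k Pf` and two equal multiples of `Pf`, into a divergence formula. -/
theorem sum_mul_fderiv_scaledPfaffian (W : Fin (2 * n) → Fin (2 * n) → 𝕜)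
    (hW : ∀ a b, W a b = -W b a)
    (W' : Fin (2 * n) → Fin (2 * n) → Fin (2 * n) → 𝕜) (hW' : ∀ l a b, W' l a b = -W' l b a)
    (hJacobi : ∀ i j k, ∑ l, (W i l * W' l j k + W j l * W' l k i + W k l * W' l i j) = 0)
    (k : Fin (2 * n)) :
    ∑ l, W l k * fderiv 𝕜 (fun W : Fin (2 * n) → Fin (2 * n) → 𝕜 => scaledPfaffian (Matrix.of W))
        W (W' l) =
      scaledPfaffian (Matrix.of W) * ∑ l, W' l l k := by
  let B : Matrix (Fin (2 * n)) (Fin (2 * n)) 𝕜 := Matrix.of fun b l => W' l b k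
  have hsum : ∑ l, W l k • W' l =
      Matrix.of.symm (B * Matrix.of W + Matrix.of W * B.transpose) := by
    ext a b
    have hab := hJacobi a b k
    simp only [Finset.sum_add_distrib] at hab
    simp only [Finset.sum_apply, Pi.smul_apply, smul_eq_mul, Matrix.of_symm_apply,
      Matrix.add_apply, Matrix.mul_apply, Matrix.transpose_apply, Matrix.of_apply, B]
    have hleft : ∑ l, W l k * W' l a b = -∑ l, W k l * W' l a b := by
      simp only [hW _ k, neg_mul, Finset.sum_neg_distrib]
    have hright : ∑ l, W' l a k * W l b = ∑ l, W b l * W' l k a := by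
      simp only [hW _ b, hW' _ a k, mul_neg, neg_neg, mul_comm]
    linear_combination hleft - hright - hab
  have h := fderiv_scaledPfaffian_apply B (Matrix.of W)
  rw [← hsum] at h
  rw [mul_comm (scaledPfaffian _)]
  simp only [map_sum, map_smul, smul_eq_mul] at h
  exact h

attribute [irreducible] scaledPfaffian

end Pfaffian

section Jacobian

variable {ι κ : Type*} [DecidableEq ι]

/-- The partial derivative `∂f/∂y_a`. -/
def partialDeriv (a : ι) (f : EuclideanSpace ℝ ι → ℝ) (y : EuclideanSpace ℝ ι) : ℝ :=
  fderiv ℝ f y (EuclideanSpace.single a 1)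

theorem fderiv_apply_eq_sum_partialDeriv [Fintype ι] (f : EuclideanSpace ℝ ι → ℝ)
    (y v : EuclideanSpace ℝ ι) :
    fderiv ℝ f y v = ∑ a, partialDeriv a f y * v a := by
  conv_lhs => rw [← (EuclideanSpace.basisFun ι ℝ).sum_repr v]
  simp only [map_sum, map_smul, smul_eq_mul, EuclideanSpace.basisFun_repr,
    EuclideanSpace.basisFun_apply, partialDeriv, mul_comm]

theorem partialDeriv_congr {f g : EuclideanSpace ℝ ι → ℝ} {y : EuclideanSpace ℝ ι}
    (h : f =ᶠ[𝓝 y] g) (a : ι) : partialDeriv a f y = partialDeriv a g y := by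
  rw [partialDeriv, h.fderiv_eq, partialDeriv]

/-- The Jacobian matrix at `y` of a map between Euclidean spaces. -/
def jacobian (F : EuclideanSpace ℝ ι → EuclideanSpace ℝ κ) (y : EuclideanSpace ℝ ι) :
    Matrix κ ι ℝ :=
  Matrix.of fun j a => partialDeriv a (fun y' => F y' j) y

theorem jacobian_apply [Finite ι] [Finite κ] {F : EuclideanSpace ℝ ι → EuclideanSpace ℝ κ}
    {y : EuclideanSpace ℝ ι} (hF : DifferentiableAt ℝ F y) (j : κ) (a : ι) :
    jacobian F y j a = fderiv ℝ F y (EuclideanSpace.single a 1) j := by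
  have := Fintype.ofFinite ι
  have := Fintype.ofFinite κ
  exact congrArg (fun L : EuclideanSpace ℝ ι →L[ℝ] ℝ => L (EuclideanSpace.single a 1))
    ((EuclideanSpace.proj (𝕜 := ℝ) j).hasFDerivAt.comp y hF.hasFDerivAt).fderiv

theorem jacobian_congr {F G : EuclideanSpace ℝ ι → EuclideanSpace ℝ κ} {y : EuclideanSpace ℝ ι}
    (h : F =ᶠ[𝓝 y] G) : jacobian F y = jacobian G y :=
  Matrix.ext fun j a => partialDeriv_congr (h.fun_comp (· j)) a

theorem jacobian_id [Finite ι] (y : EuclideanSpace ℝ ι) : jacobian (fun y' => y') y = 1 := by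
  have := Fintype.ofFinite ι
  ext j a
  rw [jacobian_apply differentiableAt_fun_id, fderiv_fun_id, ContinuousLinearMap.id_apply,
    PiLp.single_apply, Matrix.one_apply]

variable [Finite ι] [Fintype κ] [DecidableEq κ]

theorem partialDeriv_comp {F : EuclideanSpace ℝ ι → EuclideanSpace ℝ κ} {y : EuclideanSpace ℝ ι}
    (hF : DifferentiableAt ℝ F y) {g : EuclideanSpace ℝ κ → ℝ} (hg : DifferentiableAt ℝ g (F y))
    (a : ι) :
    partialDeriv a (fun y' => g (F y')) y = ∑ j, partialDeriv j g (F y) * jacobian F y j a := by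
  have := Fintype.ofFinite ι
  rw [partialDeriv, fderiv_fun_comp y hg hF, ContinuousLinearMap.comp_apply,
    fderiv_apply_eq_sum_partialDeriv]
  simp only [jacobian_apply hF]

theorem jacobian_comp {τ : Type*} [Finite τ] {F : EuclideanSpace ℝ ι → EuclideanSpace ℝ κ}
    {G : EuclideanSpace ℝ κ → EuclideanSpace ℝ τ} {y : EuclideanSpace ℝ ι}
    (hF : DifferentiableAt ℝ F y) (hG : DifferentiableAt ℝ G (F y)) :
    jacobian (fun y' => G (F y')) y = jacobian G (F y) * jacobian F y := by
  have := Fintype.ofFinite ι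
  have := Fintype.ofFinite τ
  exact Matrix.ext fun j a =>
    partialDeriv_comp hF ((EuclideanSpace.proj (𝕜 := ℝ) j).differentiableAt.comp _ hG) a

end Jacobian

section Charts

variable {n : ℕ} {M : Type*} [TopologicalSpace M] [ChartedSpace (Model n) M]
  {e e' : OpenPartialHomeomorph M (Model n)} {x : M}

theorem contDiffAt_transition (he : e ∈ charts n M) (he' : e' ∈ charts n M) {y : Model n}
    (hy : y ∈ e.target) (hy' : e.symm y ∈ e'.source) :
    ContDiffAt ℝ ∞ (fun y => e' (e.symm y)) y := by
  rw [← contMDiffAt_iff_contDiffAt]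
  exact (contMDiffAt_of_mem_maximalAtlas he' hy').comp y
    (contMDiffAt_symm_of_mem_maximalAtlas he hy)

theorem det_jacobian_transition_mul (he : e ∈ charts n M) (he' : e' ∈ charts n M)
    (hx : x ∈ e.source) (hx' : x ∈ e'.source) :
    (jacobian (fun y => e' (e.symm y)) (e x)).det *
      (jacobian (fun y => e (e'.symm y)) (e' x)).det = 1 := by
  have hd := (contDiffAt_transition he he' (e.map_source hx)
    (by rwa [e.left_inv hx])).differentiableAt (by simp)
  have hd' := (contDiffAt_transition he' he (e'.map_source hx')
    (by rwa [e'.left_inv hx'])).differentiableAt (by simp)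
  have hinv : (fun y => e (e'.symm (e' (e.symm y)))) =ᶠ[𝓝 (e x)] fun y => y := by
    filter_upwards [e.open_target.mem_nhds (e.map_source hx),
      (e.continuousAt_symm (e.map_source hx)).preimage_mem_nhds
        (e'.open_source.mem_nhds (by rwa [e.left_inv hx]))] with y hy hy'
    rw [e'.left_inv hy', e.right_inv hy]
  have hmul := jacobian_comp hd (by rwa [e.left_inv hx])
  rw [jacobian_congr hinv, jacobian_id, e.left_inv hx] at hmul
  rw [mul_comm, ← Matrix.det_mul, ← hmul, Matrix.det_one]

/-- The differential of a chart, with values in the model space itself rather than in one of its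
tangent spaces. -/
def chartDeriv (e : OpenPartialHomeomorph M (Model n)) (x : M) :
    TangentSpace (𝓡 (2 * n)) x →L[ℝ] Model n :=
  mfderiv (𝓡 (2 * n)) (𝓡 (2 * n)) e x

theorem differential_apply_of_eventuallyEq (he : e ∈ charts n M) (hx : x ∈ e.source) {f : M → ℝ}
    {g : Model n → ℝ} (hfg : f =ᶠ[𝓝 x] fun x' => g (e x')) (hg : DifferentiableAt ℝ g (e x))
    (v : TangentSpace (𝓡 (2 * n)) x) :
    differential n f x v = fderiv ℝ g (e x) (chartDeriv e x v) := by
  have hderiv := (hg.hasFDerivAt.hasMFDerivAt.comp x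
    ((contMDiffAt_of_mem_maximalAtlas he hx).mdifferentiableAt
      (by simp)).hasMFDerivAt).congr_of_eventuallyEq hfg
  exact congrArg (fun L : Model n →L[ℝ] ℝ => L v) hderiv.mfderiv

theorem coordDifferential_apply (he : e ∈ charts n M) (hx : x ∈ e.source) (j : Fin (2 * n))
    (v : TangentSpace (𝓡 (2 * n)) x) :
    coordDifferential e j x v = chartDeriv e x v j := by
  have hproj : HasFDerivAt (fun y : Model n => y j) (EuclideanSpace.proj j : Model n →L[ℝ] ℝ)
      (e x) := (EuclideanSpace.proj j : Model n →L[ℝ] ℝ).hasFDerivAt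
  rw [coordDifferential, differential_apply_of_eventuallyEq he hx .rfl hproj.differentiableAt,
    hproj.fderiv]
  rfl

theorem differential_eq_sum (he : e ∈ charts n M) (hx : x ∈ e.source) {f : M → ℝ}
    {g : Model n → ℝ} (hfg : f =ᶠ[𝓝 x] fun x' => g (e x')) (hg : DifferentiableAt ℝ g (e x)) :
    differential n f x = ∑ j, partialDeriv j g (e x) • coordDifferential e j x := by
  ext v
  rw [differential_apply_of_eventuallyEq he hx hfg hg, fderiv_apply_eq_sum_partialDeriv]
  simp only [_root_.sum_apply, _root_.smul_apply, coordDifferential_apply he hx, smul_eq_mul]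

theorem exists_eq_sum_coordDifferential (he : e ∈ charts n M) (hx : x ∈ e.source)
    (α : Cotangent n x) : ∃ a : Fin (2 * n) → ℝ, α = ∑ j, a j • coordDifferential e j x := by
  have hsmooth : e.MDifferentiable (𝓡 (2 * n)) (𝓡 (2 * n)) :=
    ⟨(contMDiffOn_of_mem_maximalAtlas he).mdifferentiableOn (by simp),
      (contMDiffOn_symm_of_mem_maximalAtlas he).mdifferentiableOn (by simp)⟩
  let A : TangentSpace (𝓡 (2 * n)) x ≃L[ℝ] Model n := hsmooth.mfderiv hx
  refine ⟨fun j => α (A.symm (EuclideanSpace.single j 1)), ?_⟩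
  ext v
  have hv : v = ∑ j, (A v) j • A.symm (EuclideanSpace.single j (1 : ℝ)) := by
    apply A.injective
    conv_lhs => rw [← (EuclideanSpace.basisFun _ ℝ).sum_repr (A v)]
    simp [map_sum]
  conv_lhs => rw [hv]
  simp only [map_sum, map_smul, smul_eq_mul, _root_.sum_apply, _root_.smul_apply,
    coordDifferential_apply he hx]
  exact Finset.sum_congr rfl fun a _ => mul_comm _ _

theorem coordDifferential_eq_sum (he : e ∈ charts n M) (he' : e' ∈ charts n M)
    (hx : x ∈ e.source) (hx' : x ∈ e'.source) (j : Fin (2 * n)) :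
    coordDifferential e' j x =
      ∑ a, jacobian (fun y => e' (e.symm y)) (e x) j a • coordDifferential e a x := by
  have hd : DifferentiableAt ℝ (fun y => e' (e.symm y) j) (e x) :=
    (EuclideanSpace.proj (𝕜 := ℝ) j).differentiableAt.comp _
      ((contDiffAt_transition he he' (e.map_source hx)
        (by rwa [e.left_inv hx])).differentiableAt (by simp))
  refine differential_eq_sum he hx ?_ hd
  filter_upwards [e.open_source.mem_nhds hx] with z hz
  rw [e.left_inv hz]

theorem component_apply_chart (w : ∀ x : M, LinearMap.BilinForm ℝ (Cotangent n x))
    (hx : x ∈ e.source) (j k : Fin (2 * n)) :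
    component w e j k (e x) = w x (coordDifferential e j x) (coordDifferential e k x) := by
  rw [component, e.left_inv hx]

theorem component_change (he : e ∈ charts n M) (he' : e' ∈ charts n M)
    (w : ∀ x : M, LinearMap.BilinForm ℝ (Cotangent n x)) (hx : x ∈ e.source) (hx' : x ∈ e'.source)
    (j k : Fin (2 * n)) :
    component w e' j k (e' x) = ∑ a, ∑ b, jacobian (fun y => e' (e.symm y)) (e x) j a *
      jacobian (fun y => e' (e.symm y)) (e x) k b * component w e a b (e x) := by
  simp only [component_apply_chart _ hx, component_apply_chart _ hx',
    coordDifferential_eq_sum he he' hx hx', map_sum, map_smul, LinearMap.sum_apply,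
    LinearMap.smul_apply, smul_eq_mul, Finset.mul_sum]
  rw [Finset.sum_comm]
  exact Finset.sum_congr rfl fun a _ => Finset.sum_congr rfl fun b _ => by ring

theorem component_swap (w : BivectorField n M) (e : OpenPartialHomeomorph M (Model n))
    (j k : Fin (2 * n)) (y : Model n) :
    component w.toFun e j k y = -component w.toFun e k j y :=
  (LinearMap.IsAlt.neg (w.isAlt (e.symm y)) _ _).symm

theorem partialDeriv_component_swap (w : BivectorField n M)
    (e : OpenPartialHomeomorph M (Model n)) (l j k : Fin (2 * n)) (y : Model n) :
    partialDeriv l (component w.toFun e j k) y = -partialDeriv l (component w.toFun e k j) y := by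
  rw [partialDeriv, funext (component_swap w e j k), fderiv_fun_neg]
  rfl

theorem contDiffAt_component (w : BivectorField n M) (he : e ∈ charts n M) {y : Model n}
    (hy : y ∈ e.target) (j k : Fin (2 * n)) : ContDiffAt ℝ ∞ (component w.toFun e j k) y :=
  (w.smooth e he j k).contDiffAt (e.open_target.mem_nhds hy)

end Charts

section WedgePow

variable {n : ℕ} {M : Type*} [TopologicalSpace M] [ChartedSpace (Model n) M]
  {e e' : OpenPartialHomeomorph M (Model n)} {x : M}

theorem wedgePow_eq_scaledPfaffian (w : BivectorField n M) (x : M)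
    (α : Fin (2 * n) → Cotangent n x) :
    w.wedgePow x α = scaledPfaffian (Matrix.of fun j k => w.toFun x (α j) (α k)) := by
  unfold scaledPfaffian
  rfl

theorem wedgePowComponent_eq_scaledPfaffian (w : BivectorField n M)
    (e : OpenPartialHomeomorph M (Model n)) (y : Model n) :
    w.wedgePowComponent e y =
      scaledPfaffian (Matrix.of fun j k => component w.toFun e j k y) :=
  wedgePow_eq_scaledPfaffian w _ _

theorem wedgePow_sum_smul (w : BivectorField n M) (A : Matrix (Fin (2 * n)) (Fin (2 * n)) ℝ)
    (β : Fin (2 * n) → Cotangent n x) :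
    w.wedgePow x (fun j => ∑ k, A j k • β k) = A.det * w.wedgePow x β := by
  rw [wedgePow_eq_scaledPfaffian, wedgePow_eq_scaledPfaffian, ← scaledPfaffian_mul_mul_transpose]
  congr 1
  ext i j
  simp only [Matrix.of_apply, map_sum, map_smul, LinearMap.sum_apply, LinearMap.smul_apply,
    smul_eq_mul, Matrix.mul_apply, Matrix.transpose_apply, mul_comm]

theorem wedgePowComponent_apply_chart (w : BivectorField n M) (hx : x ∈ e.source) :
    w.wedgePowComponent e (e x) = w.wedgePow x fun j => coordDifferential e j x := by
  rw [BivectorField.wedgePowComponent, e.left_inv hx]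

theorem wedgePowComponent_change (he : e ∈ charts n M) (he' : e' ∈ charts n M)
    (w : BivectorField n M) (hx : x ∈ e.source) (hx' : x ∈ e'.source) :
    w.wedgePowComponent e' (e' x) =
      (jacobian (fun y => e' (e.symm y)) (e x)).det * w.wedgePowComponent e (e x) := by
  rw [wedgePowComponent_apply_chart w hx, wedgePowComponent_apply_chart w hx',
    funext (coordDifferential_eq_sum he he' hx hx'), wedgePow_sum_smul]

theorem mem_singularLocus_iff (he : e ∈ charts n M) (w : BivectorField n M) (hx : x ∈ e.source) :
    x ∈ w.singularLocus ↔ w.wedgePowComponent e (e x) = 0 := by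
  rw [wedgePowComponent_apply_chart w hx]
  refine ⟨fun h => congrFun h _, fun h => funext fun α => ?_⟩
  choose A hA using fun j => exists_eq_sum_coordDifferential he hx (α j)
  have hα : α = fun j => ∑ k, Matrix.of A j k • coordDifferential e k x := funext hA
  rw [hα, wedgePow_sum_smul, h, mul_zero]
  rfl

theorem contDiffAt_wedgePowComponent (w : BivectorField n M) (he : e ∈ charts n M) {y : Model n}
    (hy : y ∈ e.target) : ContDiffAt ℝ ∞ (w.wedgePowComponent e) y := by
  rw [funext (wedgePowComponent_eq_scaledPfaffian w e)]
  exact contDiff_scaledPfaffian.contDiffAt.comp y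
    (contDiffAt_pi.2 fun j => contDiffAt_pi.2 fun k => contDiffAt_component w he hy j k)

theorem range_fderiv_prodMk_sup_eq_top_iff {E : Type*} [NormedAddCommGroup E] [NormedSpace ℝ E]
    {s : E → ℝ} {y : E} (hs : DifferentiableAt ℝ s y) :
    LinearMap.range (fderiv ℝ (fun y' => (y', s y')) y : E →ₗ[ℝ] E × ℝ) ⊔ Submodule.prod ⊤ ⊥ = ⊤ ↔
      fderiv ℝ s y ≠ 0 := by
  have hderiv : fderiv ℝ (fun y' => (y', s y')) y =
      (ContinuousLinearMap.id ℝ E).prod (fderiv ℝ s y) :=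
    ((hasFDerivAt_id y).prodMk hs.hasFDerivAt).fderiv
  rw [hderiv]
  constructor
  · intro h h0
    have h01 : ((0 : E), (1 : ℝ)) ∈ (⊤ : Submodule ℝ (E × ℝ)) := trivial
    rw [← h, h0, Submodule.mem_sup] at h01
    obtain ⟨u, ⟨v, rfl⟩, u', hu', huu'⟩ := h01
    have hsnd : u'.2 = 1 := by simpa using congrArg Prod.snd huu'
    exact one_ne_zero (hsnd.symm.trans hu'.2)
  · intro h
    obtain ⟨v, hv⟩ : ∃ v, fderiv ℝ s y v ≠ 0 := by
      by_contra! hc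
      exact h (ContinuousLinearMap.ext hc)
    refine eq_top_iff.2 fun ⟨a, b⟩ _ => Submodule.mem_sup.2 ?_
    let t := b / fderiv ℝ s y v
    refine ⟨(t • v, b), ⟨t • v, ?_⟩, (a - t • v, 0), ⟨trivial, rfl⟩, by simp⟩
    simp [t, hv]

theorem wedgePowTransverse_iff (w : BivectorField n M) :
    w.WedgePowTransverse ↔ ∀ e ∈ charts n M, ∀ y ∈ e.target, w.wedgePowComponent e y = 0 →
      fderiv ℝ (w.wedgePowComponent e) y ≠ 0 :=
  forall₄_congr fun _ he _ hy => imp_congr_right fun _ =>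
    range_fderiv_prodMk_sup_eq_top_iff
      ((contDiffAt_wedgePowComponent w he hy).differentiableAt (by simp))

end WedgePow

section Jacobi

variable {n : ℕ} {M : Type*} [TopologicalSpace M] [ChartedSpace (Model n) M]
  {e : OpenPartialHomeomorph M (Model n)} {x : M}

theorem differential_congr {f g : M → ℝ} (h : f =ᶠ[𝓝 x] g) :
    differential n f x = differential n g x :=
  ContinuousLinearMap.ext fun v => congrArg (fun L : Model n →L[ℝ] ℝ => L v)
    (h.mfderiv_eq (I := 𝓡 (2 * n)) (I' := 𝓘(ℝ, ℝ)))

variable [T2Space M] [IsManifold (𝓡 (2 * n)) ∞ M]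

theorem exists_contMDiff_eventuallyEq_one {U : Set M} (hU : IsOpen U) (hx : x ∈ U) :
    ∃ b : M → ℝ, ContMDiff (𝓡 (2 * n)) 𝓘(ℝ, ℝ) ∞ b ∧ b =ᶠ[𝓝 x] 1 ∧ tsupport b ⊆ U := by
  obtain ⟨b, -, hb⟩ := (SmoothBumpFunction.nhds_basis_tsupport (I := 𝓡 (2 * n)) x).mem_iff.1
    (hU.mem_nhds hx)
  exact ⟨b, b.contMDiff, b.eventuallyEq_one, hb⟩

theorem exists_contMDiffMap_eventuallyEq_coord (he : e ∈ charts n M) (hx : x ∈ e.source)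
    (j : Fin (2 * n)) :
    ∃ F : C^∞⟮𝓡 (2 * n), M; ℝ⟯, (F : M → ℝ) =ᶠ[𝓝 x] fun x' => e x' j := by
  obtain ⟨b, hb, hb1, hbU⟩ := exists_contMDiff_eventuallyEq_one (n := n) e.open_source hx
  have hF : ContMDiff (𝓡 (2 * n)) 𝓘(ℝ, ℝ) ∞ (fun x' => b x' * e x' j) := by
    refine contMDiff_of_tsupport fun x' hx' => ?_
    have hcoord : ContMDiffAt (𝓡 (2 * n)) 𝓘(ℝ, ℝ) ∞ (fun x' => e x' j) x' :=
      (EuclideanSpace.proj j : Model n →L[ℝ] ℝ).contDiff.contMDiff.contMDiffAt.comp x'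
        (contMDiffAt_of_mem_maximalAtlas he (hbU (tsupport_mul_subset_left hx')))
    exact hb.contMDiffAt.mul hcoord
  refine ⟨⟨_, hF⟩, ?_⟩
  filter_upwards [hb1] with x' hx'
  exact (congrArg (· * e x' j) hx').trans (one_mul _)

theorem jacobi_component {w : BivectorField n M} (hw : w.IsPoisson) (he : e ∈ charts n M)
    {y : Model n} (hy : y ∈ e.target) (i j k : Fin (2 * n)) :
    ∑ l, (component w.toFun e i l y * partialDeriv l (component w.toFun e j k) y +
      component w.toFun e j l y * partialDeriv l (component w.toFun e k i) y +
      component w.toFun e k l y * partialDeriv l (component w.toFun e i j) y) = 0 := by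
  obtain ⟨x, hx, rfl⟩ : ∃ x ∈ e.source, e x = y := ⟨e.symm y, e.map_target hy, e.right_inv hy⟩
  choose F hF using fun j => exists_contMDiffMap_eventuallyEq_coord he hx j
  have hdiff (j) : ∀ᶠ x' in 𝓝 x, differential n (F j) x' = coordDifferential e j x' :=
    (hF j).eventually_nhds.mono fun x' hx' => differential_congr hx'
  have hbracket (j k) :
      w.bracket (F j) (F k) =ᶠ[𝓝 x] fun x' => component w.toFun e j k (e x') := by
    filter_upwards [hdiff j, hdiff k, e.open_source.mem_nhds hx] with x' hj hk hx'
    rw [BivectorField.bracket, hj, hk, component_apply_chart _ hx']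
  have hbracket₂ (i j k) : w.bracket (F i) (w.bracket (F j) (F k)) x =
      ∑ l, component w.toFun e i l (e x) * partialDeriv l (component w.toFun e j k) (e x) := by
    rw [BivectorField.bracket, (hdiff i).self_of_nhds, differential_eq_sum he hx (hbracket j k)
      ((contDiffAt_component w he (e.map_source hx) j k).differentiableAt (by simp))]
    simp only [map_sum, map_smul, smul_eq_mul, component_apply_chart _ hx, mul_comm]
  simpa only [hbracket₂, Finset.sum_add_distrib] using hw (F i) (F j) (F k) x

omit [T2Space M] [IsManifold (𝓡 (2 * n)) ∞ M] in
theorem partialDeriv_wedgePowComponent (w : BivectorField n M) (he : e ∈ charts n M)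
    {y : Model n} (hy : y ∈ e.target) (l : Fin (2 * n)) :
    partialDeriv l (w.wedgePowComponent e) y =
      fderiv ℝ (fun W : Fin (2 * n) → Fin (2 * n) → ℝ => scaledPfaffian (Matrix.of W))
        (fun a b => component w.toFun e a b y)
        (fun a b => partialDeriv l (component w.toFun e a b) y) := by
  have hW : HasFDerivAt (fun y a b => component w.toFun e a b y)
      (ContinuousLinearMap.pi fun a => ContinuousLinearMap.pi fun b =>
        fderiv ℝ (component w.toFun e a b) y) y :=
    hasFDerivAt_pi.2 fun a => hasFDerivAt_pi.2 fun b =>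
      ((contDiffAt_component w he hy a b).differentiableAt (by simp)).hasFDerivAt
  have hcomp := ((contDiff_scaledPfaffian (n := n) (m := 1)).differentiable one_ne_zero
    (fun a b => component w.toFun e a b y)).hasFDerivAt.comp y hW
  rw [partialDeriv, funext (wedgePowComponent_eq_scaledPfaffian w e)]
  exact congrArg (fun L : Model n →L[ℝ] ℝ => L (EuclideanSpace.single l 1)) hcomp.fderiv

theorem sum_component_mul_partialDeriv_wedgePowComponent {w : BivectorField n M}
    (hw : w.IsPoisson) (he : e ∈ charts n M) {y : Model n} (hy : y ∈ e.target)
    (k : Fin (2 * n)) :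
    ∑ l, component w.toFun e l k y * partialDeriv l (w.wedgePowComponent e) y =
      w.wedgePowComponent e y * ∑ l, partialDeriv l (component w.toFun e l k) y := by
  simp only [partialDeriv_wedgePowComponent w he hy, wedgePowComponent_eq_scaledPfaffian]
  exact sum_mul_fderiv_scaledPfaffian (fun a b => component w.toFun e a b y)
    (component_swap w e · · y) (fun l a b => partialDeriv l (component w.toFun e a b) y)
    (partialDeriv_component_swap w e · · · y) (jacobi_component hw he hy) k

end Jacobi

section Pushforward

variable {n : ℕ} {M : Type*} [TopologicalSpace M] [ChartedSpace (Model n) M]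

/-- The pull-back of covectors by the differential of `φ` at `x`, for `y = φ x`. The point `y` is a
separate variable because `φ (φ.symm y)` is not definitionally equal to `y`. -/
def pullback (φ : Diff n M) (x y : M) : Cotangent n y →ₗ[ℝ] Cotangent n x where
  toFun α := ContinuousLinearMap.comp (M₂ := Model n) α (mfderiv (𝓡 (2 * n)) (𝓡 (2 * n)) φ x)
  map_add' _ _ := rfl
  map_smul' _ _ := rfl

theorem mdifferentiableAt_comp_diffeomorph_iff (φ : Diff n M) {f : M → ℝ} {x : M} :
    MDifferentiableAt (𝓡 (2 * n)) 𝓘(ℝ, ℝ) (f ∘ φ) x ↔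
      MDifferentiableAt (𝓡 (2 * n)) 𝓘(ℝ, ℝ) f (φ x) := by
  refine ⟨fun h => ?_, fun h => h.comp x (φ.contMDiff.contMDiffAt.mdifferentiableAt (by simp))⟩
  have hcomp : f = (f ∘ φ) ∘ φ.symm := funext fun z => by simp
  rw [hcomp]
  refine MDifferentiableAt.comp (φ x) ?_
    (φ.symm.contMDiff.contMDiffAt.mdifferentiableAt (by simp))
  rwa [φ.symm_apply_apply]

theorem pullback_differential (φ : Diff n M) {x y : M} (h : φ x = y) (f : M → ℝ) :
    pullback φ x y (differential n f y) = differential n (fun x' => f (φ x')) x := by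
  subst h
  have hchain : mfderiv (𝓡 (2 * n)) 𝓘(ℝ, ℝ) (f ∘ φ) x =
      (mfderiv (𝓡 (2 * n)) 𝓘(ℝ, ℝ) f (φ x)).comp (mfderiv (𝓡 (2 * n)) (𝓡 (2 * n)) φ x) := by
    by_cases hf : MDifferentiableAt (𝓡 (2 * n)) 𝓘(ℝ, ℝ) f (φ x)
    · exact mfderiv_comp x hf (φ.contMDiff.contMDiffAt.mdifferentiableAt (by simp))
    · rw [mfderiv_zero_of_not_mdifferentiableAt hf, mfderiv_zero_of_not_mdifferentiableAt
        (mt (mdifferentiableAt_comp_diffeomorph_iff φ).1 hf)]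
      rfl
  ext v
  exact congrArg (fun L : Model n →L[ℝ] ℝ => L v) hchain.symm

/-- The chart `e ∘ φ`. -/
def pullChart (φ : Diff n M) (e : OpenPartialHomeomorph M (Model n)) :
    OpenPartialHomeomorph M (Model n) :=
  φ.toHomeomorph.transOpenPartialHomeomorph e

theorem pullChart_apply (φ : Diff n M) (e : OpenPartialHomeomorph M (Model n)) (x : M) :
    pullChart φ e x = e (φ x) :=
  rfl

theorem pullChart_source (φ : Diff n M) (e : OpenPartialHomeomorph M (Model n)) :
    (pullChart φ e).source = φ ⁻¹' e.source :=
  rfl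

/-- The push-forward of a field of bilinear forms. -/
def pushforwardFun (φ : Diff n M) (w : ∀ x : M, LinearMap.BilinForm ℝ (Cotangent n x)) (y : M) :
    LinearMap.BilinForm ℝ (Cotangent n y) :=
  (w (φ.symm y)).compl₁₂ (pullback φ (φ.symm y) y) (pullback φ (φ.symm y) y)

theorem component_pushforwardFun (φ : Diff n M)
    (w : ∀ x : M, LinearMap.BilinForm ℝ (Cotangent n x))
    (e : OpenPartialHomeomorph M (Model n)) (j k : Fin (2 * n)) :
    component (pushforwardFun φ w) e j k = component w (pullChart φ e) j k := by
  funext y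
  have hpull : ∀ j, pullback φ (φ.symm (e.symm y)) (e.symm y)
      (coordDifferential e j (e.symm y)) =
        coordDifferential (pullChart φ e) j (φ.symm (e.symm y)) := fun j =>
    pullback_differential φ (φ.apply_symm_apply _) _
  rw [component, pushforwardFun, LinearMap.compl₁₂_apply, hpull, hpull]
  rfl

variable [IsManifold (𝓡 (2 * n)) ∞ M]

theorem pullChart_mem_charts (φ : Diff n M)
    {e : OpenPartialHomeomorph M (Model n)} (he : e ∈ charts n M) :
    pullChart φ e ∈ charts n M :=
  OpenPartialHomeomorph.mem_maximalAtlas_of_contMDiffOn _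
    ((contMDiffOn_of_mem_maximalAtlas he).comp φ.contMDiff.contMDiffOn fun _ hx => hx)
    (φ.symm.contMDiff.comp_contMDiffOn (contMDiffOn_symm_of_mem_maximalAtlas he))

/-- The push-forward `φ_* w` of a bivector field. -/
def pushforward (φ : Diff n M) (w : BivectorField n M) : BivectorField n M where
  toFun := pushforwardFun φ w.toFun
  isAlt y α := w.isAlt (φ.symm y) (pullback φ (φ.symm y) y α)
  smooth e he j k := by
    rw [component_pushforwardFun]
    exact w.smooth _ (pullChart_mem_charts φ he) j k

theorem component_pushforward (φ : Diff n M) (w : BivectorField n M)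
    (e : OpenPartialHomeomorph M (Model n)) (j k : Fin (2 * n)) :
    component (pushforward φ w).toFun e j k = component w.toFun (pullChart φ e) j k :=
  component_pushforwardFun φ w.toFun e j k

theorem wedgePowComponent_pushforward (φ : Diff n M) (w : BivectorField n M)
    (e : OpenPartialHomeomorph M (Model n)) :
    (pushforward φ w).wedgePowComponent e = w.wedgePowComponent (pullChart φ e) := by
  funext y
  simp only [wedgePowComponent_eq_scaledPfaffian, component_pushforward]

theorem isPushforward_pushforward (φ : Diff n M) (w : BivectorField n M) :
    IsPushforward φ w (pushforward φ w) := by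
  intro x α β
  change w.toFun (φ.symm (φ x)) (pullback φ (φ.symm (φ x)) (φ x) α)
    (pullback φ (φ.symm (φ x)) (φ x) β) = w.toFun x (pullback φ x (φ x) α) (pullback φ x (φ x) β)
  rw [φ.symm_apply_apply]

theorem bracket_pushforward (φ : Diff n M) (w : BivectorField n M) (f g : M → ℝ) (x : M) :
    (pushforward φ w).bracket f g (φ x) =
      w.bracket (fun x' => f (φ x')) (fun x' => g (φ x')) x := by
  rw [BivectorField.bracket, isPushforward_pushforward φ w x, BivectorField.bracket,
    ← pullback_differential φ rfl f, ← pullback_differential φ rfl g]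
  rfl

theorem isPoisson_pushforward (φ : Diff n M) {w : BivectorField n M} (hw : w.IsPoisson) :
    (pushforward φ w).IsPoisson := by
  intro f g h y
  obtain ⟨x, rfl⟩ : ∃ x, φ x = y := φ.surjective y
  simp only [bracket_pushforward]
  exact hw (f.comp ⟨φ, φ.contMDiff⟩) (g.comp ⟨φ, φ.contMDiff⟩) (h.comp ⟨φ, φ.contMDiff⟩) x

theorem isLogSymplectic_pushforward (φ : Diff n M) {w : BivectorField n M}
    (hw : w.IsLogSymplectic) : (pushforward φ w).IsLogSymplectic := by
  refine ⟨isPoisson_pushforward φ hw.1, fun e he => ?_⟩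
  rw [wedgePowComponent_pushforward]
  exact hw.2 _ (pullChart_mem_charts φ he)

theorem mem_singularLocus_pushforward (φ : Diff n M) (w : BivectorField n M) (x : M) :
    φ x ∈ (pushforward φ w).singularLocus ↔ x ∈ w.singularLocus := by
  have he : chartAt (Model n) (φ x) ∈ charts n M := IsManifold.chart_mem_maximalAtlas _
  rw [mem_singularLocus_iff he _ (mem_chart_source _ _), wedgePowComponent_pushforward,
    mem_singularLocus_iff (pullChart_mem_charts φ he) w (x := x) (mem_chart_source _ (φ x)),
    pullChart_apply]

end Pushforward

/-! ### Continuous families for the `C¹`-topology -/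

section Topology

theorem continuousAt_of_continuous_ofFun {X Y β : Type*} [TopologicalSpace X] [TopologicalSpace Y]
    [LocallyCompactSpace Y] [UniformSpace β] {U : Set Y} (hU : IsOpen U) {f : X → Y → β}
    (hf : Continuous fun x => UniformOnFun.ofFun {K | IsCompact K ∧ K ⊆ U} (f x)) {x : X} {y : Y}
    (hy : y ∈ U) (hx : ContinuousAt (f x) y) :
    ContinuousAt (fun q : X × Y => f q.1 q.2) (x, y) := by
  have hK : ∃ K ∈ {K | IsCompact K ∧ K ⊆ U}, K ∈ 𝓝 y := by
    obtain ⟨K, hK, hyK, hKU⟩ := exists_compact_subset hU hy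
    exact ⟨K, ⟨hK, hKU⟩, mem_interior_iff_mem_nhds.1 hyK⟩
  exact ContinuousAt.comp (x := (x, y))
    (f := fun q : X × Y => (UniformOnFun.ofFun {K | IsCompact K ∧ K ⊆ U} (f q.1), q.2))
    (UniformOnFun.continuousAt_eval₂ hK hx)
    ((hf.comp continuous_fst).prodMk continuous_snd).continuousAt

theorem continuous_ofFun_of_continuousAt {X Y β : Type*} [TopologicalSpace X] [TopologicalSpace Y]
    [UniformSpace β] {𝔖 : Set (Set Y)} {f : X → Y → β}
    (h : ∀ K ∈ 𝔖, IsCompact K ∧ ∀ x, ∀ y ∈ K, ContinuousAt (Function.uncurry f) (x, y)) :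
    Continuous fun x => UniformOnFun.ofFun 𝔖 (f x) := by
  refine continuous_iff_continuousAt.2 fun x => ?_
  rw [ContinuousAt, UniformOnFun.tendsto_iff_tendstoUniformlyOn]
  intro K hK u hu
  obtain ⟨v, hv, hvu⟩ := (h K hK).1.mem_uniformity_of_prod (f := f) (s := Set.univ) (q := x)
    (fun q hq => ((h K hK).2 q.1 q.2 hq.2).continuousWithinAt) (Set.mem_univ x)
    (symm_le_uniformity hu)
  rw [nhdsWithin_univ] at hv
  filter_upwards [hv] with x' hx' y hy using hvu x' hx' y hy

variable {n : ℕ} {M : Type*} [TopologicalSpace M] [ChartedSpace (Model n) M]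
  {e : OpenPartialHomeomorph M (Model n)}

theorem continuous_ofFun_component (he : e ∈ charts n M) (j k : Fin (2 * n)) :
    (Continuous fun w : BivectorField n M =>
      UniformOnFun.ofFun (chartCompacts e) (component w.toFun e j k)) ∧
    Continuous fun w : BivectorField n M =>
      UniformOnFun.ofFun (chartCompacts e) (fderiv ℝ (component w.toFun e j k)) := by
  rw [continuous_iff_le_induced, continuous_iff_le_induced, ← le_inf_iff]
  exact iInf_le_of_le e (iInf_le_of_le he (iInf_le_of_le j (iInf_le _ k)))

theorem continuousAt_component (he : e ∈ charts n M) (w : BivectorField n M) {y : Model n}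
    (hy : y ∈ e.target) (j k : Fin (2 * n)) :
    ContinuousAt (fun q : BivectorField n M × Model n => component q.1.toFun e j k q.2) (w, y) :=
  continuousAt_of_continuous_ofFun e.open_target (continuous_ofFun_component he j k).1 hy
    (contDiffAt_component w he hy j k).continuousAt

theorem continuousAt_fderiv_component (he : e ∈ charts n M) (w : BivectorField n M) {y : Model n}
    (hy : y ∈ e.target) (j k : Fin (2 * n)) :
    ContinuousAt (fun q : BivectorField n M × Model n =>
      fderiv ℝ (component q.1.toFun e j k) q.2) (w, y) :=
  continuousAt_of_continuous_ofFun e.open_target (continuous_ofFun_component he j k).2 hy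
    ((contDiffAt_component w he hy j k).continuousAt_fderiv (by simp))

end Topology

section C1FamilyAt

variable {P Q : Type*} [TopologicalSpace P] [TopologicalSpace Q] {E F G : Type*}
  [NormedAddCommGroup E] [NormedSpace ℝ E] [NormedAddCommGroup F] [NormedSpace ℝ F]
  [NormedAddCommGroup G] [NormedSpace ℝ G]

/-- A family of smooth functions `f p`, depending continuously on the parameter in the
`C¹`-topology near `(p, y)`: near this point, the functions and their first derivatives are jointly
continuous. -/
def C1FamilyAt (f : P → E → F) (p : P) (y : E) : Prop :=
  ∀ᶠ q : P × E in 𝓝 (p, y), ContDiffAt ℝ ∞ (f q.1) q.2 ∧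
    ContinuousAt (fun q : P × E => f q.1 q.2) q ∧
    ContinuousAt (fun q : P × E => fderiv ℝ (f q.1) q.2) q

namespace C1FamilyAt

variable {f : P → E → F} {p : P} {y : E}

theorem contDiffAt (h : C1FamilyAt f p y) : ContDiffAt ℝ ∞ (f p) y :=
  h.self_of_nhds.1

theorem differentiableAt (h : C1FamilyAt f p y) : DifferentiableAt ℝ (f p) y :=
  h.contDiffAt.differentiableAt (by simp)

theorem continuousAt (h : C1FamilyAt f p y) : ContinuousAt (fun q : P × E => f q.1 q.2) (p, y) :=
  h.self_of_nhds.2.1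

theorem continuousAt_fderiv (h : C1FamilyAt f p y) :
    ContinuousAt (fun q : P × E => fderiv ℝ (f q.1) q.2) (p, y) :=
  h.self_of_nhds.2.2

theorem eventually (h : C1FamilyAt f p y) : ∀ᶠ q : P × E in 𝓝 (p, y), C1FamilyAt f q.1 q.2 :=
  h.eventually_nhds

theorem of_eventually_hasFDerivAt {f' : P → E → E →L[ℝ] F}
    (h : ∀ᶠ q : P × E in 𝓝 (p, y), ContDiffAt ℝ ∞ (f q.1) q.2 ∧
      ContinuousAt (fun q : P × E => f q.1 q.2) q ∧ HasFDerivAt (f q.1) (f' q.1 q.2) q.2 ∧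
      ContinuousAt (fun q : P × E => f' q.1 q.2) q) : C1FamilyAt f p y := by
  filter_upwards [h.eventually_nhds] with q hq
  obtain ⟨hsmooth, hcont, -, hcont'⟩ := hq.self_of_nhds
  exact ⟨hsmooth, hcont, hcont'.congr_of_eventuallyEq (hq.mono fun r hr => hr.2.2.1.fderiv)⟩

theorem congr {f' : P → E → F} (h : C1FamilyAt f p y)
    (hff' : ∀ᶠ q : P × E in 𝓝 (p, y), f' q.1 q.2 = f q.1 q.2) : C1FamilyAt f' p y := by
  have hslice : ∀ᶠ q : P × E in 𝓝 (p, y), f' q.1 =ᶠ[𝓝 q.2] f q.1 := by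
    filter_upwards [hff'.eventually_nhds] with q hq
    rw [← Prod.mk.eta (p := q), nhds_prod_eq] at hq
    exact hq.curry.self_of_nhds
  refine of_eventually_hasFDerivAt (f' := fun p y => fderiv ℝ (f p) y) ?_
  filter_upwards [h.eventually, hff'.eventually_nhds, hslice] with q hq hev hqslice
  exact ⟨hq.contDiffAt.congr_of_eventuallyEq hqslice, hq.continuousAt.congr_of_eventuallyEq hev,
    hq.differentiableAt.hasFDerivAt.congr_of_eventuallyEq hqslice, hq.continuousAt_fderiv⟩

theorem comp_param {f : Q → E → F} {g : P → Q} (hf : C1FamilyAt f (g p) y) (hg : Continuous g) :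
    C1FamilyAt (fun p => f (g p)) p y := by
  have hmap : Continuous fun q : P × E => (g q.1, q.2) := by fun_prop
  filter_upwards [hmap.continuousAt.eventually hf] with q hq
  exact ⟨hq.1, ContinuousAt.comp (f := fun q : P × E => (g q.1, q.2)) hq.2.1 hmap.continuousAt,
    ContinuousAt.comp (f := fun q : P × E => (g q.1, q.2)) hq.2.2 hmap.continuousAt⟩

theorem of_contDiffAt {g : E → F} (hg : ∀ᶠ y' in 𝓝 y, ContDiffAt ℝ ∞ g y') (p : P) :
    C1FamilyAt (fun _ => g) p y := by
  have hev : ∀ᶠ q : P × E in 𝓝 (p, y), ContDiffAt ℝ ∞ g q.2 := continuousAt_snd.eventually hg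
  filter_upwards [hev] with q hq
  exact ⟨hq, ContinuousAt.comp (f := Prod.snd) hq.continuousAt continuousAt_snd,
    ContinuousAt.comp (f := Prod.snd) (hq.continuousAt_fderiv (by simp)) continuousAt_snd⟩

theorem of_contDiff {g : E → F} (hg : ContDiff ℝ ∞ g) (p : P) (y : E) :
    C1FamilyAt (fun _ => g) p y :=
  of_contDiffAt (Filter.Eventually.of_forall fun _ => hg.contDiffAt) p

theorem comp {g : P → F → G} (hg : C1FamilyAt g p (f p y)) (hf : C1FamilyAt f p y) :
    C1FamilyAt (fun p y => g p (f p y)) p y := by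
  have hgraph : ∀ {q : P × E}, C1FamilyAt f q.1 q.2 →
      ContinuousAt (fun q : P × E => (q.1, f q.1 q.2)) q :=
    fun hq => continuousAt_fst.prodMk hq.continuousAt
  refine of_eventually_hasFDerivAt
    (f' := fun p y => (fderiv ℝ (g p) (f p y)).comp (fderiv ℝ (f p) y)) ?_
  filter_upwards [(hgraph hf).eventually hg.eventually, hf.eventually] with q hgq hfq
  exact ⟨hgq.contDiffAt.comp q.2 hfq.contDiffAt,
    ContinuousAt.comp (f := fun q : P × E => (q.1, f q.1 q.2)) hgq.continuousAt (hgraph hfq),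
    hgq.differentiableAt.hasFDerivAt.comp q.2 hfq.differentiableAt.hasFDerivAt,
    (ContinuousAt.comp (f := fun q : P × E => (q.1, f q.1 q.2)) hgq.continuousAt_fderiv
      (hgraph hfq)).clm_comp hfq.continuousAt_fderiv⟩

theorem contDiff_comp {g : F → G} (hg : ContDiff ℝ ∞ g) (hf : C1FamilyAt f p y) :
    C1FamilyAt (fun p y => g (f p y)) p y :=
  comp (g := fun _ => g) (of_contDiff hg p _) hf

theorem prodMk {g : P → E → G} (hf : C1FamilyAt f p y) (hg : C1FamilyAt g p y) :
    C1FamilyAt (fun p y => (f p y, g p y)) p y := by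
  refine of_eventually_hasFDerivAt
    (f' := fun p y => (fderiv ℝ (f p) y).prod (fderiv ℝ (g p) y)) ?_
  filter_upwards [hf.eventually, hg.eventually] with q hfq hgq
  exact ⟨hfq.contDiffAt.prodMk hgq.contDiffAt, hfq.continuousAt.prodMk hgq.continuousAt,
    hfq.differentiableAt.hasFDerivAt.prodMk hgq.differentiableAt.hasFDerivAt,
    (ContinuousLinearMap.prodₗᵢ ℝ (𝕜 := ℝ) (E := E) (F := F) (G := G)).continuous.continuousAt.comp
      (hfq.continuousAt_fderiv.prodMk hgq.continuousAt_fderiv)⟩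

theorem pi {ι : Type*} [Fintype ι] {f : P → E → ι → F}
    (hf : ∀ i, C1FamilyAt (fun p y => f p y i) p y) : C1FamilyAt f p y := by
  classical
  refine of_eventually_hasFDerivAt (f' := fun p y =>
    ContinuousLinearMap.pi fun i => fderiv ℝ (fun y => f p y i) y) ?_
  filter_upwards [Filter.eventually_all.2 fun i => (hf i).eventually] with q hq
  refine ⟨contDiffAt_pi.2 fun i => (hq i).contDiffAt,
    continuousAt_pi.2 fun i => (hq i).continuousAt,
    hasFDerivAt_pi.2 fun i => (hq i).differentiableAt.hasFDerivAt, ?_⟩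
  have hsum : ∀ A : ι → E →L[ℝ] F, ContinuousLinearMap.pi A =
      ∑ i, (ContinuousLinearMap.single ℝ (fun _ : ι => F) i).comp (A i) := by
    intro A
    ext v i
    simp [Finset.sum_apply, Pi.single_apply]
  simp only [hsum]
  exact tendsto_finsetSum _ fun i _ => continuousAt_const.clm_comp (hq i).continuousAt_fderiv

theorem mul {f g : P → E → ℝ} (hf : C1FamilyAt f p y) (hg : C1FamilyAt g p y) :
    C1FamilyAt (fun p y => f p y * g p y) p y :=
  contDiff_comp (g := fun v : ℝ × ℝ => v.1 * v.2) (contDiff_fst.mul contDiff_snd) (hf.prodMk hg)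

theorem sub {g : P → E → F} (hf : C1FamilyAt f p y) (hg : C1FamilyAt g p y) :
    C1FamilyAt (fun p y => f p y - g p y) p y :=
  contDiff_comp (g := fun v : F × F => v.1 - v.2) (contDiff_fst.sub contDiff_snd) (hf.prodMk hg)

theorem add {g : P → E → F} (hf : C1FamilyAt f p y) (hg : C1FamilyAt g p y) :
    C1FamilyAt (fun p y => f p y + g p y) p y :=
  contDiff_comp (g := fun v : F × F => v.1 + v.2) (contDiff_fst.add contDiff_snd) (hf.prodMk hg)

theorem const (c : F) (p : P) (y : E) : C1FamilyAt (fun _ _ => c) p y :=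
  of_contDiff (g := fun _ => c) contDiff_const p y

theorem id (p : P) (y : E) : C1FamilyAt (fun _ y => y) p y :=
  of_contDiff (g := fun y => y) contDiff_id p y

theorem div {f g : P → E → ℝ} (hf : C1FamilyAt f p y) (hg : C1FamilyAt g p y)
    (hgy : g p y ≠ 0) : C1FamilyAt (fun p y => f p y / g p y) p y := by
  have hinv : C1FamilyAt (fun (_ : P) (t : ℝ) => t⁻¹) p (g p y) :=
    of_contDiffAt ((isOpen_ne.eventually_mem hgy).mono fun t ht => contDiffAt_inv ℝ ht) p
  simpa only [div_eq_mul_inv] using hf.mul (comp hinv hg)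

end C1FamilyAt

end C1FamilyAt

section Families

theorem tendsto_prod_symm {P X Y : Type*} [TopologicalSpace P] [TopologicalSpace X]
    [TopologicalSpace Y] {e : OpenPartialHomeomorph X Y} (p : P) {x : X} (hx : x ∈ e.source) :
    Filter.Tendsto (fun q : P × Y => (q.1, e.symm q.2)) (𝓝 (p, e x)) (𝓝 (p, x)) := by
  have h : ContinuousAt (fun q : P × Y => (q.1, e.symm q.2)) (p, e x) :=
    continuousAt_fst.prodMk (ContinuousAt.comp (f := Prod.snd)
      (e.continuousAt_symm (e.map_source hx)) continuousAt_snd)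
  simpa only [ContinuousAt, e.left_inv hx] using h

theorem tendsto_prod_chart {P X Y : Type*} [TopologicalSpace P] [TopologicalSpace X]
    [TopologicalSpace Y] {e : OpenPartialHomeomorph X Y} (p : P) {x : X} (hx : x ∈ e.source) :
    Filter.Tendsto (fun q : P × X => (q.1, e q.2)) (𝓝 (p, x)) (𝓝 (p, e x)) :=
  continuousAt_fst.prodMk (ContinuousAt.comp (f := Prod.snd) (e.continuousAt hx) continuousAt_snd)

variable {n : ℕ} {M : Type*} [TopologicalSpace M] [ChartedSpace (Model n) M]
  {P Q : Type*} [TopologicalSpace P] [TopologicalSpace Q]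
  {e e' : OpenPartialHomeomorph M (Model n)}

theorem c1FamilyAt_component {w : P → BivectorField n M} (hw : Continuous w) (he : e ∈ charts n M)
    (p : P) {y : Model n} (hy : y ∈ e.target) (j k : Fin (2 * n)) :
    C1FamilyAt (fun p => component (w p).toFun e j k) p y := by
  refine C1FamilyAt.comp_param (f := fun w => component w.toFun e j k) ?_ hw
  filter_upwards [continuousAt_snd.eventually (e.open_target.mem_nhds hy)] with q hq
  exact ⟨contDiffAt_component q.1 he hq j k, continuousAt_component he q.1 hq j k,
    continuousAt_fderiv_component he q.1 hq j k⟩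

theorem c1FamilyAt_wedgePowComponent {w : P → BivectorField n M} (hw : Continuous w)
    (he : e ∈ charts n M) (p : P) {y : Model n} (hy : y ∈ e.target) :
    C1FamilyAt (fun p => (w p).wedgePowComponent e) p y := by
  have h : C1FamilyAt (fun p y j k => component (w p).toFun e j k y) p y :=
    C1FamilyAt.pi fun j => C1FamilyAt.pi fun k => c1FamilyAt_component hw he p hy j k
  exact (C1FamilyAt.contDiff_comp contDiff_scaledPfaffian h).congr
    (Filter.Eventually.of_forall fun q => wedgePowComponent_eq_scaledPfaffian _ _ _)

theorem c1FamilyAt_transition (he : e ∈ charts n M) (he' : e' ∈ charts n M) (p : P) {y : Model n}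
    (hy : y ∈ e.target) (hy' : e.symm y ∈ e'.source) :
    C1FamilyAt (fun _ y => e' (e.symm y)) p y := by
  refine C1FamilyAt.of_contDiffAt ?_ p
  filter_upwards [e.open_target.mem_nhds hy,
    (e.continuousAt_symm hy).preimage_mem_nhds (e'.open_source.mem_nhds hy')] with z hz hz'
  exact contDiffAt_transition he he' hz hz'

/-- A family of smooth maps `Φ p : M → M`, depending continuously on the parameter in the
`C¹`-topology near `(p, x)`: in suitable charts around `x` and `Φ p x` it is such a family of
functions. -/
def C1MapFamilyAt (Φ : P → M → M) (p : P) (x : M) : Prop :=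
  ∃ e ∈ charts n M, ∃ e' ∈ charts n M, x ∈ e.source ∧
    (∀ᶠ q : P × M in 𝓝 (p, x), Φ q.1 q.2 ∈ e'.source) ∧
    C1FamilyAt (fun p y => e' (Φ p (e.symm y))) p (e x)

namespace C1MapFamilyAt

variable {Φ : P → M → M} {p : P} {x : M}

theorem continuousAt (h : C1MapFamilyAt (n := n) Φ p x) :
    ContinuousAt (fun q : P × M => Φ q.1 q.2) (p, x) := by
  obtain ⟨e, -, e', -, hx, hΦ, hc⟩ := h
  have hcont :
      ContinuousAt (fun q : P × M => e'.symm (e' (Φ q.1 (e.symm (e q.2))))) (p, x) := by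
    refine ContinuousAt.comp (g := e'.symm) (f := fun q : P × M => e' (Φ q.1 (e.symm (e q.2)))) ?_
      (hc.continuousAt.tendsto.comp (tendsto_prod_chart p hx))
    refine e'.continuousAt_symm (e'.map_source ?_)
    simpa only [e.left_inv hx] using hΦ.self_of_nhds
  refine hcont.congr ?_
  filter_upwards [hΦ, continuousAt_snd.eventually (e.open_source.mem_nhds hx)] with q hq hqe
  rw [e.left_inv hqe, e'.left_inv hq]

theorem eventually (h : C1MapFamilyAt (n := n) Φ p x) :
    ∀ᶠ q : P × M in 𝓝 (p, x), C1MapFamilyAt (n := n) Φ q.1 q.2 := by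
  obtain ⟨e, he, e', he', hx, hΦ, hc⟩ := h
  filter_upwards [hΦ.eventually_nhds, continuousAt_snd.eventually (e.open_source.mem_nhds hx),
    (tendsto_prod_chart p hx).eventually hc.eventually] with q hqΦ hqx hqc
  exact ⟨e, he, e', he', hqx, hqΦ, hqc⟩

theorem c1FamilyAt (h : C1MapFamilyAt (n := n) Φ p x) (he : e ∈ charts n M) (he' : e' ∈ charts n M)
    (hx : x ∈ e.source) (hΦx : Φ p x ∈ e'.source) :
    C1FamilyAt (fun p y => e' (Φ p (e.symm y))) p (e x) := by
  obtain ⟨e₁, he₁, e₁', he₁', hx₁, hΦ, hc⟩ := h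
  have hΦx₁ : Φ p x ∈ e₁'.source := hΦ.self_of_nhds
  have hsource : C1FamilyAt (fun p y => e₁' (Φ p (e₁.symm (e₁ (e.symm y))))) p (e x) :=
    C1FamilyAt.comp (g := fun p y => e₁' (Φ p (e₁.symm y))) (f := fun _ y => e₁ (e.symm y))
      (by simpa only [e.left_inv hx] using hc)
      (c1FamilyAt_transition he he₁ p (e.map_source hx) (by rwa [e.left_inv hx]))
  have htarget : C1FamilyAt (fun _ y => e' (e₁'.symm y)) p (e₁' (Φ p x)) :=
    c1FamilyAt_transition he₁' he' p (e₁'.map_source hΦx₁) (by rwa [e₁'.left_inv hΦx₁])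
  refine (C1FamilyAt.comp (g := fun _ y => e' (e₁'.symm y))
    (by simpa only [e.left_inv hx, e₁.left_inv hx₁] using htarget) hsource).congr ?_
  filter_upwards [(tendsto_prod_symm p hx).eventually hΦ, (tendsto_prod_symm p hx).eventually
    (continuousAt_snd.eventually (e₁.open_source.mem_nhds hx₁))] with q hqΦ hqx₁
  rw [e₁.left_inv hqx₁, e₁'.left_inv hqΦ]

theorem congr {Φ' : P → M → M} (h : C1MapFamilyAt (n := n) Φ p x)
    (hΦ : ∀ᶠ q : P × M in 𝓝 (p, x), Φ' q.1 q.2 = Φ q.1 q.2) :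
    C1MapFamilyAt (n := n) Φ' p x := by
  obtain ⟨e, he, e', he', hx, hΦe, hc⟩ := h
  refine ⟨e, he, e', he', hx, ?_, hc.congr ?_⟩
  · filter_upwards [hΦe, hΦ] with q hq hqΦ
    rwa [hqΦ]
  · filter_upwards [(tendsto_prod_symm p hx).eventually hΦ] with q hqΦ
    rw [hqΦ]

theorem comp_param {Φ : Q → M → M} {g : P → Q} (h : C1MapFamilyAt (n := n) Φ (g p) x)
    (hg : Continuous g) : C1MapFamilyAt (n := n) (fun p => Φ (g p)) p x := by
  obtain ⟨e, he, e', he', hx, hΦ, hc⟩ := h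
  have hmap : ContinuousAt (fun q : P × M => (g q.1, q.2)) (p, x) := by fun_prop
  exact ⟨e, he, e', he', hx, hmap.eventually hΦ, hc.comp_param hg⟩

theorem id [IsManifold (𝓡 (2 * n)) ∞ M] (p : P) (x : M) :
    C1MapFamilyAt (n := n) (fun _ x => x) p x := by
  have he : chartAt (Model n) x ∈ charts n M := IsManifold.chart_mem_maximalAtlas _
  have hx : x ∈ (chartAt (Model n) x).source := mem_chart_source _ x
  exact ⟨_, he, _, he, hx, continuousAt_snd.eventually
    ((chartAt (Model n) x).open_source.mem_nhds hx), c1FamilyAt_transition he he p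
    (mem_chart_target _ x) (by rwa [(chartAt (Model n) x).left_inv hx])⟩

end C1MapFamilyAt

end Families

/-! ### Matching the top wedge powers -/

section Straighten

theorem exists_openPartialHomeomorph_of_contDiffAt {E : Type*} [NormedAddCommGroup E]
    [NormedSpace ℝ E] [CompleteSpace E] {G : E → E} {U : Set E} (hU : IsOpen U)
    (hG : ∀ y ∈ U, ContDiffAt ℝ ∞ G y) {a : E} (ha : a ∈ U) {A : E ≃L[ℝ] E}
    (hA : HasFDerivAt G (A : E →L[ℝ] E) a) :
    ∃ g : OpenPartialHomeomorph E E, a ∈ g.source ∧ (∀ y, g y = G y) ∧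
      ContDiffOn ℝ ∞ g g.source ∧ ContDiffOn ℝ ∞ g.symm g.target := by
  let g₀ := (hG a ha).toOpenPartialHomeomorph G hA (by simp)
  have hcont : ContinuousOn (fderiv ℝ G) U := fun y hy =>
    ((hG y hy).continuousAt_fderiv (by simp)).continuousWithinAt
  let S := U ∩ fderiv ℝ G ⁻¹' Set.range ((↑) : (E ≃L[ℝ] E) → E →L[ℝ] E)
  have hS : IsOpen S := hcont.isOpen_inter_preimage hU ContinuousLinearEquiv.isOpen
  have haS : a ∈ S := ⟨ha, A, hA.fderiv.symm⟩
  let g := g₀.restrOpen S hS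
  have hsource : g.source ⊆ S := fun y hy => hy.2
  refine ⟨g, ⟨(hG a ha).mem_toOpenPartialHomeomorph_source hA (by simp), haS⟩,
    fun y => rfl, fun y hy => (hG y (hsource hy).1).contDiffWithinAt, fun y hy => ?_⟩
  obtain ⟨hyU, B, hB⟩ := hsource (g.map_target hy)
  have hderiv : HasFDerivAt g (B : E →L[ℝ] E) (g.symm y) :=
    hB ▸ ((hG _ hyU).differentiableAt (by simp)).hasFDerivAt
  exact (g.contDiffAt_symm hy hderiv (hG _ hyU)).contDiffWithinAt

theorem exists_equiv_replace_coord {m : ℕ} (L : EuclideanSpace ℝ (Fin m) →L[ℝ] ℝ) {i : Fin m}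
    (hL : L (EuclideanSpace.single i 1) ≠ 0) :
    ∃ A : EuclideanSpace ℝ (Fin m) ≃L[ℝ] EuclideanSpace ℝ (Fin m),
      (A : EuclideanSpace ℝ (Fin m) →L[ℝ] EuclideanSpace ℝ (Fin m)) =
        ContinuousLinearMap.id ℝ _ +
          (L - EuclideanSpace.proj i).smulRight (EuclideanSpace.single i (1 : ℝ)) := by
  let D : EuclideanSpace ℝ (Fin m) →L[ℝ] EuclideanSpace ℝ (Fin m) := ContinuousLinearMap.id ℝ _ +
    (L - EuclideanSpace.proj i).smulRight (EuclideanSpace.single i (1 : ℝ))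
  have hinj : Function.Injective (D : EuclideanSpace ℝ (Fin m) →ₗ[ℝ] EuclideanSpace ℝ (Fin m)) := by
    rw [injective_iff_map_eq_zero]
    intro v hv
    have hv : v + (L v - v i) • EuclideanSpace.single i (1 : ℝ) = 0 := hv
    have hLv : L v = 0 := by simpa using congrArg (· i) hv
    have hv_single : v = v i • EuclideanSpace.single i (1 : ℝ) := by
      rwa [hLv, zero_sub, neg_smul, ← sub_eq_add_neg, sub_eq_zero] at hv
    have hvi : v i = 0 := by
      have := congrArg L hv_single
      rw [hLv, map_smul, smul_eq_mul, eq_comm, mul_eq_zero] at this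
      exact this.resolve_right hL
    rw [hv_single, hvi, zero_smul]
  exact ⟨(LinearEquiv.ofInjectiveEndo _ hinj).toContinuousLinearEquiv, by ext v; rfl⟩

variable {n : ℕ} {M : Type*} [TopologicalSpace M] [ChartedSpace (Model n) M]
  [IsManifold (𝓡 (2 * n)) ∞ M]

theorem trans_mem_charts {e : OpenPartialHomeomorph M (Model n)} (he : e ∈ charts n M)
    {g : OpenPartialHomeomorph (Model n) (Model n)} (hg : ContDiffOn ℝ ∞ g g.source)
    (hg' : ContDiffOn ℝ ∞ g.symm g.target) : e.trans g ∈ charts n M := by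
  refine OpenPartialHomeomorph.mem_maximalAtlas_of_contMDiffOn _
    ((contMDiffOn_iff_contDiffOn.2 hg).comp
      ((contMDiffOn_of_mem_maximalAtlas he).mono fun x hx => ?_) fun x hx => ?_)
    ((contMDiffOn_symm_of_mem_maximalAtlas he).comp
      ((contMDiffOn_iff_contDiffOn.2 hg').mono fun y hy => ?_) fun y hy => ?_)
  · exact (e.trans_source g ▸ hx).1
  · exact (e.trans_source g ▸ hx).2
  · exact (e.trans_target g ▸ hy).1
  · exact (e.trans_target g ▸ hy).2

theorem exists_chart_coord_eq {e₀ : OpenPartialHomeomorph M (Model n)} (he₀ : e₀ ∈ charts n M)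
    {f : Model n → ℝ} (hf : ∀ y ∈ e₀.target, ContDiffAt ℝ ∞ f y) {x : M} (hx : x ∈ e₀.source)
    (hfx : fderiv ℝ f (e₀ x) ≠ 0) :
    ∃ (i : Fin (2 * n)) (e : OpenPartialHomeomorph M (Model n)), e ∈ charts n M ∧ x ∈ e.source ∧
      e.source ⊆ e₀.source ∧ ∀ x' ∈ e.source, e x' i = f (e₀ x') := by
  obtain ⟨i, hi⟩ : ∃ i, fderiv ℝ f (e₀ x) (EuclideanSpace.single i 1) ≠ 0 := by
    by_contra! hpartial
    refine hfx (ContinuousLinearMap.ext fun v => ?_)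
    rw [fderiv_apply_eq_sum_partialDeriv]
    simp [partialDeriv, hpartial]
  obtain ⟨A, hA⟩ := exists_equiv_replace_coord _ hi
  let G : Model n → Model n := fun y =>
    y + (f y - (EuclideanSpace.proj i : Model n →L[ℝ] ℝ) y) • EuclideanSpace.single i (1 : ℝ)
  have hG : ∀ y ∈ e₀.target, ContDiffAt ℝ ∞ G y := fun y hy =>
    contDiffAt_id.add (((hf y hy).sub (ContinuousLinearMap.contDiff _).contDiffAt).smul
      contDiffAt_const)
  have hGA : HasFDerivAt G (A : Model n →L[ℝ] Model n) (e₀ x) := by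
    rw [hA]
    exact (hasFDerivAt_id _).add ((((hf _ (e₀.map_source hx)).differentiableAt
      (by simp)).hasFDerivAt.sub (ContinuousLinearMap.hasFDerivAt _)).smul_const _)
  obtain ⟨g, hxg, hgG, hg, hg'⟩ := exists_openPartialHomeomorph_of_contDiffAt
    e₀.open_target hG (e₀.map_source hx) hGA
  refine ⟨i, e₀.trans g, trans_mem_charts he₀ hg hg', e₀.trans_source g ▸ ⟨hx, hxg⟩,
    fun x' hx' => (e₀.trans_source g ▸ hx').1, fun x' _ => ?_⟩
  rw [OpenPartialHomeomorph.coe_trans, Function.comp_apply, hgG]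
  simp [G]

end Straighten

section Ratio

theorem contDiffAt_det_jacobian {ι : Type*} [Fintype ι] [DecidableEq ι]
    {F : EuclideanSpace ℝ ι → EuclideanSpace ℝ ι} {y : EuclideanSpace ℝ ι}
    (hF : ContDiffAt ℝ ∞ F y) : ContDiffAt ℝ ∞ (fun y => (jacobian F y).det) y := by
  have hentry : ∀ j a, ContDiffAt ℝ ∞ (fun y => jacobian F y j a) y := fun j a =>
    (((EuclideanSpace.proj (𝕜 := ℝ) j).contDiff.contDiffAt.comp y hF).fderiv_right
      (m := ∞) (by simp)).clm_apply contDiffAt_const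
  simp only [Matrix.det_apply]
  exact ContDiffAt.sum fun σ _ => (contDiffAt_prod fun j _ => hentry _ _).const_smul _

variable {n : ℕ} {M : Type*} [TopologicalSpace M] [ChartedSpace (Model n) M]
  {P Q : Type*} [TopologicalSpace P] [TopologicalSpace Q]
  {e e' e₁ : OpenPartialHomeomorph M (Model n)}

theorem c1FamilyAt_det_jacobian_transition (he : e ∈ charts n M) (he' : e' ∈ charts n M) (p : P)
    {y : Model n} (hy : y ∈ e.target) (hy' : e.symm y ∈ e'.source) :
    C1FamilyAt (fun _ y => (jacobian (fun y => e' (e.symm y)) y).det) p y := by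
  refine C1FamilyAt.of_contDiffAt ?_ p
  filter_upwards [e.open_target.mem_nhds hy,
    (e.continuousAt_symm hy).preimage_mem_nhds (e'.open_source.mem_nhds hy')] with z hz hz'
  exact contDiffAt_det_jacobian (contDiffAt_transition he he' hz hz')

/-- Near `(p, x)`, the function `⋀ⁿ w₀ ∘ Φ p` in the chart `e` is a multiple of `⋀ⁿ (w p)` in the
chart `e'`; the factor is a family of smooth functions, continuous in the `C¹`-topology, with value
`r` at `(p, x)`. -/
def HasWedgePowRatioAt (w₀ : BivectorField n M) (w : P → BivectorField n M) (Φ : P → M → M)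
    (e' e : OpenPartialHomeomorph M (Model n)) (r : ℝ) (p : P) (x : M) : Prop :=
  ∃ c : P → Model n → ℝ, C1FamilyAt c p (e' x) ∧ c p (e' x) = r ∧
    ∀ᶠ q : P × Model n in 𝓝 (p, e' x), w₀.wedgePowComponent e (e (Φ q.1 (e'.symm q.2))) =
      c q.1 q.2 * (w q.1).wedgePowComponent e' q.2

namespace HasWedgePowRatioAt

variable {w₀ : BivectorField n M} {w : P → BivectorField n M} {Φ : P → M → M} {p : P} {x : M}
  {r : ℝ}

theorem congr {Φ' : P → M → M} (h : HasWedgePowRatioAt w₀ w Φ e' e r p x) (hx : x ∈ e'.source)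
    (hΦ : ∀ᶠ q : P × M in 𝓝 (p, x), Φ' q.1 q.2 = Φ q.1 q.2) :
    HasWedgePowRatioAt w₀ w Φ' e' e r p x := by
  obtain ⟨c, hc, hr, hratio⟩ := h
  refine ⟨c, hc, hr, ?_⟩
  filter_upwards [hratio, (tendsto_prod_symm p hx).eventually hΦ] with q hq hqΦ
  rw [← hq, hqΦ]

theorem eventually (h : HasWedgePowRatioAt w₀ w Φ e' e r p x) (hr : r ≠ 0) (hx : x ∈ e'.source) :
    ∀ᶠ q : P × M in 𝓝 (p, x), ∃ r ≠ 0, HasWedgePowRatioAt w₀ w Φ e' e r q.1 q.2 := by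
  obtain ⟨c, hc, rfl, hratio⟩ := h
  filter_upwards [(tendsto_prod_chart p hx).eventually ((hc.continuousAt.eventually_ne hr).and
    (hc.eventually.and hratio.eventually_nhds))] with q ⟨hqr, hqc, hq⟩
  exact ⟨_, hqr, c, hqc, rfl, hq⟩

theorem comp_param {w : Q → BivectorField n M} {Φ : Q → M → M} {g : P → Q}
    (h : HasWedgePowRatioAt w₀ w Φ e' e r (g p) x) (hg : Continuous g) :
    HasWedgePowRatioAt w₀ (fun p => w (g p)) (fun p => Φ (g p)) e' e r p x := by
  obtain ⟨c, hc, hr, hratio⟩ := h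
  have hmap : ContinuousAt (fun q : P × Model n => (g q.1, q.2)) (p, e' x) := by fun_prop
  exact ⟨fun p => c (g p), hc.comp_param hg, hr, hmap.eventually hratio⟩

theorem change_target (h : HasWedgePowRatioAt w₀ w Φ e' e r p x)
    (hΦ : C1MapFamilyAt (n := n) Φ p x) (he : e ∈ charts n M) (he' : e' ∈ charts n M)
    (he₁ : e₁ ∈ charts n M) (hx : x ∈ e'.source) (hΦx : Φ p x ∈ e.source)
    (hΦx₁ : Φ p x ∈ e₁.source) :
    HasWedgePowRatioAt w₀ w Φ e' e₁
      ((jacobian (fun y => e₁ (e.symm y)) (e (Φ p x))).det * r) p x := by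
  obtain ⟨c, hc, rfl, hratio⟩ := h
  have hJ : C1FamilyAt (fun p y => (jacobian (fun y => e₁ (e.symm y))
      (e (Φ p (e'.symm y)))).det) p (e' x) := by
    refine C1FamilyAt.comp (g := fun _ y => (jacobian (fun y => e₁ (e.symm y)) y).det)
      (f := fun p y => e (Φ p (e'.symm y))) ?_ (hΦ.c1FamilyAt he' he hx hΦx)
    rw [e'.left_inv hx]
    exact c1FamilyAt_det_jacobian_transition he he₁ p (e.map_source hΦx) (by rwa [e.left_inv hΦx])
  refine ⟨_, hJ.mul hc, by rw [e'.left_inv hx], ?_⟩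
  filter_upwards [hratio, (tendsto_prod_symm p hx).eventually (hΦ.continuousAt.eventually
    ((e.open_source.inter e₁.open_source).mem_nhds ⟨hΦx, hΦx₁⟩))] with q hq ⟨hqe, hqe₁⟩
  rw [wedgePowComponent_change he he₁ w₀ hqe hqe₁, hq, mul_assoc]

theorem change_source (h : HasWedgePowRatioAt w₀ w Φ e' e r p x) (he' : e' ∈ charts n M)
    (he₁ : e₁ ∈ charts n M) (hx : x ∈ e'.source) (hx₁ : x ∈ e₁.source) :
    HasWedgePowRatioAt w₀ w Φ e₁ e (r * (jacobian (fun y => e' (e₁.symm y)) (e₁ x)).det) p x := by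
  obtain ⟨c, hc, rfl, hratio⟩ := h
  have hx₁' : e₁.symm (e₁ x) ∈ e'.source := by rwa [e₁.left_inv hx₁]
  have hτ : C1FamilyAt (fun _ y => e' (e₁.symm y)) p (e₁ x) :=
    c1FamilyAt_transition he₁ he' p (e₁.map_source hx₁) hx₁'
  have hcτ : C1FamilyAt (fun p y => c p (e' (e₁.symm y))) p (e₁ x) :=
    C1FamilyAt.comp (f := fun _ y => e' (e₁.symm y)) (by rwa [e₁.left_inv hx₁]) hτ
  refine ⟨_, hcτ.mul (c1FamilyAt_det_jacobian_transition he₁ he' p (e₁.map_source hx₁) hx₁'),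
    by rw [e₁.left_inv hx₁], ?_⟩
  filter_upwards [(tendsto_prod_symm p hx₁).eventually ((tendsto_prod_chart p hx).eventually
      hratio), continuousAt_snd.eventually (e₁.open_target.mem_nhds (e₁.map_source hx₁)),
    (tendsto_prod_symm p hx₁).eventually (continuousAt_snd.eventually
      ((e'.open_source.inter e₁.open_source).mem_nhds ⟨hx, hx₁⟩))] with q hq hqt ⟨hqe', hqe₁⟩
  simp only [e'.left_inv hqe'] at hq
  rw [hq, wedgePowComponent_change he₁ he' (w q.1) hqe₁ hqe', e₁.right_inv hqt, mul_assoc]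

end HasWedgePowRatioAt

end Ratio

section ShiftCoord

variable {n : ℕ} {M : Type*} [TopologicalSpace M] {e : OpenPartialHomeomorph M (Model n)}
  {i : Fin (2 * n)} {t : ℝ} {x : M}

open Classical in
/-- Moves a point in the domain of the chart `e` by `t` in the direction of the `i`-th coordinate,
and keeps all other points fixed. This is meaningful if `t` is so small that the point does not
leave the image of the chart. -/
def shiftCoord (e : OpenPartialHomeomorph M (Model n)) (i : Fin (2 * n)) (t : ℝ) (x : M) : M :=
  if x ∈ e.source then e.symm (e x + t • EuclideanSpace.single i (1 : ℝ)) else x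

theorem shiftCoord_zero : shiftCoord e i 0 x = x := by
  classical
  rw [shiftCoord, zero_smul, add_zero, ite_eq_right_iff]
  exact e.left_inv

theorem shiftCoord_mem_source (hx : x ∈ e.source)
    (ht : e x + t • EuclideanSpace.single i (1 : ℝ) ∈ e.target) :
    shiftCoord e i t x ∈ e.source := by
  rw [shiftCoord, if_pos hx]
  exact e.map_target ht

theorem chart_shiftCoord (hx : x ∈ e.source)
    (ht : e x + t • EuclideanSpace.single i (1 : ℝ) ∈ e.target) :
    e (shiftCoord e i t x) = e x + t • EuclideanSpace.single i (1 : ℝ) := by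
  rw [shiftCoord, if_pos hx, e.right_inv ht]

variable [ChartedSpace (Model n) M] {P : Type*} [TopologicalSpace P] {Φ : P → M → M}
  {τ : P → M → ℝ} {p : P}

theorem c1FamilyAt_add_smul_single (hΦ : C1MapFamilyAt (n := n) Φ p x) (he : e ∈ charts n M)
    (hx : x ∈ e.source) (hΦx : Φ p x ∈ e.source)
    (hτ : C1FamilyAt (fun p y => τ p (e.symm y)) p (e x)) :
    C1FamilyAt (fun p y => e (Φ p (e.symm y)) +
      τ p (e.symm y) • EuclideanSpace.single i (1 : ℝ)) p (e x) :=
  (hΦ.c1FamilyAt he he hx hΦx).add (C1FamilyAt.contDiff_comp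
    (g := fun t : ℝ => t • (EuclideanSpace.single i (1 : ℝ) : Model n))
    (contDiff_id.smul contDiff_const) hτ)

theorem eventually_add_smul_single_mem_target (hΦ : C1MapFamilyAt (n := n) Φ p x)
    (he : e ∈ charts n M) (hx : x ∈ e.source) (hΦx : Φ p x ∈ e.source)
    (hτ : C1FamilyAt (fun p y => τ p (e.symm y)) p (e x))
    (ht : e (Φ p x) + τ p x • EuclideanSpace.single i (1 : ℝ) ∈ e.target) :
    ∀ᶠ q : P × M in 𝓝 (p, x), Φ q.1 q.2 ∈ e.source ∧
      e (Φ q.1 q.2) + τ q.1 q.2 • EuclideanSpace.single i (1 : ℝ) ∈ e.target := by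
  have htarget := (tendsto_prod_chart p hx).eventually
    ((c1FamilyAt_add_smul_single (i := i) hΦ he hx hΦx hτ).continuousAt.eventually
      (e.open_target.mem_nhds (by simpa only [e.left_inv hx] using ht)))
  filter_upwards [htarget, continuousAt_snd.eventually (e.open_source.mem_nhds hx),
    hΦ.continuousAt.eventually (e.open_source.mem_nhds hΦx)] with q hq hqx hqΦ
  exact ⟨hqΦ, by rwa [e.left_inv hqx] at hq⟩

theorem C1MapFamilyAt.shiftCoord (hΦ : C1MapFamilyAt (n := n) Φ p x)
    (he : e ∈ charts n M) (hx : x ∈ e.source) (hΦx : Φ p x ∈ e.source)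
    (hτ : C1FamilyAt (fun p y => τ p (e.symm y)) p (e x))
    (ht : e (Φ p x) + τ p x • EuclideanSpace.single i (1 : ℝ) ∈ e.target) :
    C1MapFamilyAt (n := n) (fun p x => shiftCoord e i (τ p x) (Φ p x)) p x := by
  have htarget := eventually_add_smul_single_mem_target hΦ he hx hΦx hτ ht
  refine ⟨e, he, e, he, hx, htarget.mono fun q hq => shiftCoord_mem_source hq.1 hq.2,
    (c1FamilyAt_add_smul_single (i := i) hΦ he hx hΦx hτ).congr ?_⟩
  filter_upwards [(tendsto_prod_symm p hx).eventually htarget] with q hq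
  exact chart_shiftCoord hq.1 hq.2

end ShiftCoord

section Adjust

variable {n : ℕ} {M : Type*} [TopologicalSpace M] [ChartedSpace (Model n) M]
  {P : Type*} [TopologicalSpace P]

/-- `Φ` is, near `p₀`, a family of smooth maps with `Φ p₀ = id`, continuous in the
`C¹`-topology. -/
def IsFamilyThroughId (p₀ : P) (Φ : P → M → M) : Prop :=
  (∀ x, Φ p₀ x = x) ∧ ∀ x, C1MapFamilyAt (n := n) Φ p₀ x

/-- Near `(p₀, x)`, the function `⋀ⁿ (w p₀) ∘ Φ p` is a multiple of `⋀ⁿ (w p)`, with factor `1` at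
`(p₀, x)`. -/
def MatchesAt (w : P → BivectorField n M) (p₀ : P) (Φ : P → M → M) (x : M) : Prop :=
  ∃ e ∈ charts n M, x ∈ e.source ∧ HasWedgePowRatioAt (w p₀) w Φ e e 1 p₀ x

/-- `e` is a chart inside `e₀` whose `i`-th coordinate is `⋀ⁿ w₀` in the chart `e₀`, and `b` is a
cut-off function for `e`. -/
structure IsStraightening (w₀ : BivectorField n M) (e₀ e : OpenPartialHomeomorph M (Model n))
    (i : Fin (2 * n)) (b : M → ℝ) : Prop where
  mem_charts₀ : e₀ ∈ charts n M
  mem_charts : e ∈ charts n M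
  source_subset : e.source ⊆ e₀.source
  coord_eq : ∀ x ∈ e.source, e x i = w₀.wedgePowComponent e₀ (e₀ x)
  contMDiff : ContMDiff (𝓡 (2 * n)) 𝓘(ℝ, ℝ) ∞ b
  tsupport_subset : tsupport b ⊆ e.source

/-- The amount by which the `i`-th coordinate of `Φ p x` in the chart `e` has to be changed in order
to become `⋀ⁿ (w p)` in the chart `e₀`, cut off by `b`. -/
def adjustment (w : P → BivectorField n M) (e₀ e : OpenPartialHomeomorph M (Model n))
    (i : Fin (2 * n)) (b : M → ℝ) (Φ : P → M → M) (p : P) (x : M) : ℝ :=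
  b (Φ p x) * ((w p).wedgePowComponent e₀ (e₀ x) - e (Φ p x) i)

/-- The family `Φ`, with the `i`-th coordinate in the chart `e` corrected by `adjustment`. -/
def adjust (w : P → BivectorField n M) (e₀ e : OpenPartialHomeomorph M (Model n))
    (i : Fin (2 * n)) (b : M → ℝ) (Φ : P → M → M) (p : P) (x : M) : M :=
  shiftCoord e i (adjustment w e₀ e i b Φ p x) (Φ p x)

variable {w : P → BivectorField n M} {p₀ : P} {Φ : P → M → M}
  {e₀ e : OpenPartialHomeomorph M (Model n)} {i : Fin (2 * n)} {b : M → ℝ} {x : M}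

theorem C1MapFamilyAt.comp_contMDiff {p : P} (hΦ : C1MapFamilyAt (n := n) Φ p x)
    (hb : ContMDiff (𝓡 (2 * n)) 𝓘(ℝ, ℝ) ∞ b) (he : e ∈ charts n M) (hx : x ∈ e.source) :
    C1FamilyAt (fun p y => b (Φ p (e.symm y))) p (e x) := by
  obtain ⟨_, _, e', he', _, hΦe', _⟩ := _root_.id hΦ
  have hΦx : Φ p x ∈ e'.source := hΦe'.self_of_nhds
  have hb' : ∀ᶠ y in 𝓝 (e' (Φ p x)), ContDiffAt ℝ ∞ (fun y => b (e'.symm y)) y := by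
    filter_upwards [e'.open_target.mem_nhds (e'.map_source hΦx)] with y hy
    rw [← contMDiffAt_iff_contDiffAt]
    exact hb.contMDiffAt.comp y (contMDiffAt_symm_of_mem_maximalAtlas he' hy)
  refine (C1FamilyAt.comp (g := fun _ y => b (e'.symm y)) (f := fun p y => e' (Φ p (e.symm y)))
    (C1FamilyAt.of_contDiffAt (by simpa only [e.left_inv hx] using hb') p)
    (hΦ.c1FamilyAt he he' hx hΦx)).congr ?_
  filter_upwards [(tendsto_prod_symm p hx).eventually hΦe'] with q hq
  rw [e'.left_inv hq]

theorem adjustment_self (h : IsStraightening (w p₀) e₀ e i b)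
    (hΦ : IsFamilyThroughId (n := n) p₀ Φ) : adjustment w e₀ e i b Φ p₀ x = 0 := by
  rw [adjustment, hΦ.1, mul_eq_zero, sub_eq_zero]
  by_cases hx : x ∈ e.source
  · exact Or.inr (h.coord_eq x hx).symm
  · exact Or.inl (image_eq_zero_of_notMem_tsupport fun hb => hx (h.tsupport_subset hb))

theorem add_adjustment_smul_mem_target (h : IsStraightening (w p₀) e₀ e i b)
    (hΦ : IsFamilyThroughId (n := n) p₀ Φ) (hx : x ∈ e.source) :
    e (Φ p₀ x) + adjustment w e₀ e i b Φ p₀ x • EuclideanSpace.single i (1 : ℝ) ∈ e.target := by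
  rw [adjustment_self h hΦ, zero_smul, add_zero, hΦ.1]
  exact e.map_source hx

theorem adjust_eventually_eq (h : IsStraightening (w p₀) e₀ e i b)
    (hΦ : IsFamilyThroughId (n := n) p₀ Φ) (hx : x ∉ e.source) :
    ∀ᶠ q : P × M in 𝓝 (p₀, x), adjust w e₀ e i b Φ q.1 q.2 = Φ q.1 q.2 := by
  have hx' : Φ p₀ x ∉ tsupport b := by
    rw [hΦ.1]
    exact fun hb => hx (h.tsupport_subset hb)
  filter_upwards [(hΦ.2 x).continuousAt.eventually
    ((isClosed_tsupport b).isOpen_compl.mem_nhds hx')] with q hq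
  rw [adjust, adjustment, image_eq_zero_of_notMem_tsupport hq, zero_mul, shiftCoord_zero]

section

variable (hw : Continuous w)
include hw

theorem c1FamilyAt_adjustment (h : IsStraightening (w p₀) e₀ e i b)
    (hΦ : IsFamilyThroughId (n := n) p₀ Φ) (hx : x ∈ e.source) :
    C1FamilyAt (fun p y => adjustment w e₀ e i b Φ p (e.symm y)) p₀ (e x) := by
  have hx₀ : e.symm (e x) ∈ e₀.source := by
    rw [e.left_inv hx]
    exact h.source_subset hx
  have hs : C1FamilyAt (fun p y => (w p).wedgePowComponent e₀ (e₀ (e.symm y))) p₀ (e x) :=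
    C1FamilyAt.comp (f := fun _ y => e₀ (e.symm y))
      (c1FamilyAt_wedgePowComponent hw h.mem_charts₀ p₀ (e₀.map_source hx₀))
      (c1FamilyAt_transition h.mem_charts h.mem_charts₀ p₀ (e.map_source hx) hx₀)
  exact ((hΦ.2 x).comp_contMDiff h.contMDiff h.mem_charts hx).mul
    (hs.sub (C1FamilyAt.contDiff_comp (EuclideanSpace.proj (𝕜 := ℝ) i).contDiff
      ((hΦ.2 x).c1FamilyAt h.mem_charts h.mem_charts hx (by rwa [hΦ.1]))))

theorem isFamilyThroughId_adjust (h : IsStraightening (w p₀) e₀ e i b)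
    (hΦ : IsFamilyThroughId (n := n) p₀ Φ) :
    IsFamilyThroughId (n := n) p₀ (adjust w e₀ e i b Φ) := by
  refine ⟨fun x => ?_, fun x => ?_⟩
  · rw [adjust, adjustment_self h hΦ, shiftCoord_zero, hΦ.1]
  · by_cases hx : x ∈ e.source
    · exact (hΦ.2 x).shiftCoord h.mem_charts hx (by rwa [hΦ.1])
        (c1FamilyAt_adjustment hw h hΦ hx) (add_adjustment_smul_mem_target h hΦ hx)
    · exact (hΦ.2 x).congr (adjust_eventually_eq h hΦ hx)

theorem wedgePowComponent_adjust (h : IsStraightening (w p₀) e₀ e i b)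
    (hΦ : IsFamilyThroughId (n := n) p₀ Φ) (hx : x ∈ e.source) :
    ∀ᶠ q : P × M in 𝓝 (p₀, x),
      (w p₀).wedgePowComponent e₀ (e₀ (adjust w e₀ e i b Φ q.1 q.2)) =
        (1 - b (Φ q.1 q.2)) * (w p₀).wedgePowComponent e₀ (e₀ (Φ q.1 q.2)) +
          b (Φ q.1 q.2) * (w q.1).wedgePowComponent e₀ (e₀ q.2) := by
  filter_upwards [eventually_add_smul_single_mem_target (hΦ.2 x) h.mem_charts hx (by rwa [hΦ.1])
    (c1FamilyAt_adjustment hw h hΦ hx) (add_adjustment_smul_mem_target h hΦ hx)] with q ⟨hqΦ, hqt⟩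
  rw [adjust, ← h.coord_eq _ (shiftCoord_mem_source hqΦ hqt), ← h.coord_eq _ hqΦ,
    chart_shiftCoord hqΦ hqt, adjustment]
  simp only [PiLp.add_apply, PiLp.smul_apply, PiLp.single_apply, if_true, smul_eq_mul]
  ring

theorem MatchesAt.adjust (hm : MatchesAt w p₀ Φ x) (h : IsStraightening (w p₀) e₀ e i b)
    (hΦ : IsFamilyThroughId (n := n) p₀ Φ) : MatchesAt w p₀ (adjust w e₀ e i b Φ) x := by
  obtain ⟨e₁, he₁, hx₁, hratio⟩ := hm
  by_cases hx : x ∈ e.source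
  · have he₀ := h.mem_charts₀
    have hx₀ := h.source_subset hx
    have hratio₀ := (hratio.change_target (hΦ.2 x) he₁ he₁ he₀ hx₁ (by rwa [hΦ.1])
      (by rwa [hΦ.1])).change_source he₁ he₀ hx₁ hx₀
    rw [hΦ.1, mul_one, det_jacobian_transition_mul he₁ he₀ hx₁ hx₀] at hratio₀
    obtain ⟨c, hc, hc1, hratio₀⟩ := hratio₀
    have hb := (hΦ.2 x).comp_contMDiff h.contMDiff he₀ hx₀
    refine ⟨e₀, he₀, hx₀, _, (((C1FamilyAt.const (1 : ℝ) p₀ (e₀ x)).sub hb).mul hc).add hb,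
      by rw [hc1]; ring, ?_⟩
    filter_upwards [hratio₀, (tendsto_prod_symm p₀ hx₀).eventually
      (wedgePowComponent_adjust hw h hΦ hx),
      continuousAt_snd.eventually (e₀.open_target.mem_nhds (e₀.map_source hx₀))] with q hq hqa hqt
    rw [hqa, hq, e₀.right_inv hqt]
    ring
  · exact ⟨e₁, he₁, hx₁, hratio.congr hx₁ (adjust_eventually_eq h hΦ hx)⟩

theorem matchesAt_adjust_of_eventuallyEq_one (h : IsStraightening (w p₀) e₀ e i b)
    (hΦ : IsFamilyThroughId (n := n) p₀ Φ) (hx : x ∈ e.source) (hbx : b =ᶠ[𝓝 x] 1) :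
    MatchesAt w p₀ (adjust w e₀ e i b Φ) x := by
  have hx₀ := h.source_subset hx
  refine ⟨e₀, h.mem_charts₀, hx₀, fun _ _ => 1, C1FamilyAt.const 1 p₀ _, rfl, ?_⟩
  have hb : ∀ᶠ q : P × M in 𝓝 (p₀, x), b (Φ q.1 q.2) = 1 :=
    (hΦ.2 x).continuousAt.eventually (p := fun z => b z = 1) (by simp only [hΦ.1]; exact hbx)
  filter_upwards [(tendsto_prod_symm p₀ hx₀).eventually
    ((wedgePowComponent_adjust hw h hΦ hx).and hb),
    continuousAt_snd.eventually (e₀.open_target.mem_nhds (e₀.map_source hx₀))] with q ⟨hq, hqb⟩ hqt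
  rw [hq, hqb, e₀.right_inv hqt]
  ring

end

variable [IsManifold (𝓡 (2 * n)) ∞ M]

theorem isClosed_singularLocus (w : BivectorField n M) : IsClosed w.singularLocus := by
  rw [← isOpen_compl_iff, isOpen_iff_mem_nhds]
  intro x hx
  have he : chartAt (Model n) x ∈ charts n M := IsManifold.chart_mem_maximalAtlas _
  have hxe : x ∈ (chartAt (Model n) x).source := mem_chart_source _ x
  have hcont := (contDiffAt_wedgePowComponent w he (mem_chart_target _ x)).continuousAt.comp
    ((chartAt (Model n) x).continuousAt hxe)
  filter_upwards [hcont.eventually_ne fun h => hx ((mem_singularLocus_iff he w hxe).2 h),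
    (chartAt (Model n) x).open_source.mem_nhds hxe] with x' hx' hxe' hmem
  exact hx' ((mem_singularLocus_iff he w hxe').1 hmem)

variable [T2Space M]

theorem exists_isStraightening {w₀ : BivectorField n M} (hw₀ : w₀.WedgePowTransverse) {z : M}
    (hz : z ∈ w₀.singularLocus) :
    ∃ e₀ e i b, IsStraightening w₀ e₀ e i b ∧ z ∈ e.source ∧ b =ᶠ[𝓝 z] 1 := by
  have he₀ : chartAt (Model n) z ∈ charts n M := IsManifold.chart_mem_maximalAtlas _
  have hz₀ : z ∈ (chartAt (Model n) z).source := mem_chart_source _ z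
  obtain ⟨i, e, he, hze, hee₀, hi⟩ := exists_chart_coord_eq he₀
    (fun y hy => contDiffAt_wedgePowComponent w₀ he₀ hy) hz₀
    ((wedgePowTransverse_iff w₀).1 hw₀ _ he₀ _ (mem_chart_target _ z)
      ((mem_singularLocus_iff he₀ w₀ hz₀).1 hz))
  obtain ⟨b, hb, hb1, hbe⟩ := exists_contMDiff_eventuallyEq_one (n := n) e.open_source hze
  exact ⟨_, e, i, b, ⟨he₀, he, hee₀, hi, hb, hbe⟩, hze, hb1⟩

theorem exists_nhds_forall_exists_matchesAt (hw : Continuous w) (hp₀ : (w p₀).WedgePowTransverse)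
    {z : M} (hz : z ∈ (w p₀).singularLocus) :
    ∃ U ∈ 𝓝 z, ∀ Φ, IsFamilyThroughId (n := n) p₀ Φ → ∃ Φ', IsFamilyThroughId (n := n) p₀ Φ' ∧
      (∀ x ∈ U, MatchesAt w p₀ Φ' x) ∧ ∀ x, MatchesAt w p₀ Φ x → MatchesAt w p₀ Φ' x := by
  obtain ⟨e₀, e, i, b, h, hze, hb⟩ := exists_isStraightening hp₀ hz
  exact ⟨{x | x ∈ e.source ∧ b =ᶠ[𝓝 x] 1},
    Filter.inter_mem (e.open_source.mem_nhds hze) hb.eventually_nhds, fun Φ hΦ =>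
    ⟨adjust w e₀ e i b Φ, isFamilyThroughId_adjust hw h hΦ,
      fun x hx => matchesAt_adjust_of_eventuallyEq_one hw h hΦ hx.1 hx.2,
      fun x hx => hx.adjust hw h hΦ⟩⟩

theorem exists_isFamilyThroughId_matchesAt [CompactSpace M] (hw : Continuous w)
    (hp₀ : (w p₀).WedgePowTransverse) :
    ∃ Φ, IsFamilyThroughId (n := n) p₀ Φ ∧ ∀ x ∈ (w p₀).singularLocus, MatchesAt w p₀ Φ x := by
  have hall : ∀ Φ, IsFamilyThroughId (n := n) p₀ Φ → ∃ Φ', IsFamilyThroughId (n := n) p₀ Φ' ∧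
      (∀ x ∈ (w p₀).singularLocus, MatchesAt w p₀ Φ' x) ∧
        ∀ x, MatchesAt w p₀ Φ x → MatchesAt w p₀ Φ' x := by
    refine IsCompact.induction_on (isClosed_singularLocus (w p₀)).isCompact
      (p := fun s => ∀ Φ, IsFamilyThroughId (n := n) p₀ Φ → ∃ Φ', IsFamilyThroughId (n := n) p₀ Φ' ∧
        (∀ x ∈ s, MatchesAt w p₀ Φ' x) ∧ ∀ x, MatchesAt w p₀ Φ x → MatchesAt w p₀ Φ' x) ?_ ?_ ?_ ?_
    · exact fun Φ hΦ => ⟨Φ, hΦ, by simp, fun _ => id⟩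
    · intro s t hst ht Φ hΦ
      obtain ⟨Φ', hΦ', hmatch, hpres⟩ := ht Φ hΦ
      exact ⟨Φ', hΦ', fun x hx => hmatch x (hst hx), hpres⟩
    · intro s t hs ht Φ hΦ
      obtain ⟨Φ₁, hΦ₁, hmatch₁, hpres₁⟩ := hs Φ hΦ
      obtain ⟨Φ₂, hΦ₂, hmatch₂, hpres₂⟩ := ht Φ₁ hΦ₁
      exact ⟨Φ₂, hΦ₂, fun x hx => hx.elim (fun hx => hpres₂ x (hmatch₁ x hx)) (hmatch₂ x),
        fun x hx => hpres₂ x (hpres₁ x hx)⟩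
    · intro z hz
      obtain ⟨U, hU, hstep⟩ := exists_nhds_forall_exists_matchesAt hw hp₀ hz
      exact ⟨U, mem_nhdsWithin_of_mem_nhds hU, hstep⟩
  obtain ⟨Φ, hΦ, hmatch, -⟩ := hall (fun _ x => x) ⟨fun _ => rfl, fun x => C1MapFamilyAt.id p₀ x⟩
  exact ⟨Φ, hΦ, hmatch⟩

end Adjust

section LocalInjectivity

variable {P : Type*} [TopologicalSpace P] {E : Type*} [NormedAddCommGroup E] [NormedSpace ℝ E]

theorem C1FamilyAt.eventually_eq_of_apply_eq {F : P → E → E} {p : P} {a : E}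
    (hF : C1FamilyAt F p a) (hid : fderiv ℝ (F p) a = ContinuousLinearMap.id ℝ E) :
    ∀ᶠ q : P × (E × E) in 𝓝 (p, (a, a)), F q.1 q.2.1 = F q.1 q.2.2 → q.2.1 = q.2.2 := by
  have hderiv : ∀ᶠ q : P × E in 𝓝 (p, a), DifferentiableAt ℝ (F q.1) q.2 ∧
      ‖fderiv ℝ (F q.1) q.2 - ContinuousLinearMap.id ℝ E‖ ≤ 1 / 2 := by
    refine (hF.eventually.mono fun q hq => hq.differentiableAt).and
      ((hF.continuousAt_fderiv.sub continuousAt_const).norm.eventually (eventually_le_nhds ?_))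
    simp [hid]
  rw [nhds_prod_eq, Filter.eventually_prod_iff] at hderiv
  obtain ⟨V, hV, W, hW, hVW⟩ := hderiv
  obtain ⟨ε, hε, hball⟩ := Metric.eventually_nhds_iff_ball.1 hW
  have hpair : ∀ᶠ b : E × E in 𝓝 (a, a), b.1 ∈ Metric.ball a ε ∧ b.2 ∈ Metric.ball a ε :=
    prod_mem_nhds (Metric.ball_mem_nhds a hε) (Metric.ball_mem_nhds a hε)
  filter_upwards [continuousAt_fst.eventually hV, continuousAt_snd.eventually hpair]
    with q hqV ⟨hq₁, hq₂⟩ heq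
  have hmv := (convex_ball a ε).norm_image_sub_le_of_norm_fderiv_le' (𝕜 := ℝ)
    (f := F q.1) (φ := ContinuousLinearMap.id ℝ E) (C := 1 / 2)
    (fun y hy => (hVW hqV (hball y hy)).1) (fun y hy => (hVW hqV (hball y hy)).2) hq₁ hq₂
  rw [heq, sub_self, zero_sub, norm_neg, ContinuousLinearMap.id_apply] at hmv
  have hnorm : ‖q.2.2 - q.2.1‖ = 0 := by linarith [norm_nonneg (q.2.2 - q.2.1)]
  exact (sub_eq_zero.1 (norm_eq_zero.1 hnorm)).symm

end LocalInjectivity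

section LocalDiffeomorph

variable {H N H' N' : Type*} [TopologicalSpace H] [TopologicalSpace N] [ChartedSpace H N]
  [TopologicalSpace H'] [TopologicalSpace N'] [ChartedSpace H' N']
  {E E' : Type*} [NormedAddCommGroup E] [NormedSpace ℝ E] [NormedAddCommGroup E']
  [NormedSpace ℝ E'] {I : ModelWithCorners ℝ E H} {I' : ModelWithCorners ℝ E' H'}

theorem isLocalDiffeomorphAt_of_eqOn {k : OpenPartialHomeomorph N N'}
    (hk : ContMDiffOn I I' ∞ k k.source) (hk' : ContMDiffOn I' I ∞ k.symm k.target) {f : N → N'}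
    (hf : Set.EqOn f k k.source) {x : N} (hx : x ∈ k.source) :
    IsLocalDiffeomorphAt I I' ∞ f x :=
  ⟨{ k with contMDiffOn_toFun := hk, contMDiffOn_invFun := hk' }, hx, hf⟩

theorem isLocalDiffeomorphAt_congr {f g : N → N'} {x : N} (hf : IsLocalDiffeomorphAt I I' ∞ f x)
    (hfg : g =ᶠ[𝓝 x] f) : IsLocalDiffeomorphAt I I' ∞ g x := by
  obtain ⟨k, hx, hfk⟩ := hf
  obtain ⟨U, hU, hUo, hxU⟩ := eventually_nhds_iff.1 hfg
  refine isLocalDiffeomorphAt_of_eqOn (k := k.toOpenPartialHomeomorph.restrOpen U hUo)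
    (k.contMDiffOn_toFun.mono fun y hy => hy.1) (k.contMDiffOn_invFun.mono fun y hy => hy.1)
    (fun y hy => (hU y hy.2).trans (hfk hy.1)) ⟨hx, hxU⟩

theorem isLocalDiffeomorphAt_of_hasFDerivAt [CompleteSpace E] {G : E → E} {a : E}
    (hG : ∀ᶠ y in 𝓝 a, ContDiffAt ℝ ∞ G y) {A : E ≃L[ℝ] E} (hA : HasFDerivAt G (A : E →L[ℝ] E) a) :
    IsLocalDiffeomorphAt 𝓘(ℝ, E) 𝓘(ℝ, E) ∞ G a := by
  obtain ⟨U, hU, hUo, haU⟩ := eventually_nhds_iff.1 hG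
  obtain ⟨g, hag, hgG, hg, hg'⟩ := exists_openPartialHomeomorph_of_contDiffAt hUo hU haU hA
  exact isLocalDiffeomorphAt_of_eqOn (contMDiffOn_iff_contDiffOn.2 hg)
    (contMDiffOn_iff_contDiffOn.2 hg') (fun y _ => (hgG y).symm) hag

end LocalDiffeomorph

section Diffeo

variable {n : ℕ} {M : Type*} [TopologicalSpace M] [ChartedSpace (Model n) M]
  {e e' : OpenPartialHomeomorph M (Model n)} {x : M}

theorem isLocalDiffeomorphAt_of_fderiv {f : M → M} (hf : ContinuousAt f x)
    (he : e ∈ charts n M) (he' : e' ∈ charts n M) (hx : x ∈ e.source) (hfx : f x ∈ e'.source)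
    (hd : ∀ᶠ y in 𝓝 (e x), ContDiffAt ℝ ∞ (fun y => e' (f (e.symm y))) y)
    {A : Model n ≃L[ℝ] Model n}
    (hA : fderiv ℝ (fun y => e' (f (e.symm y))) (e x) = (A : Model n →L[ℝ] Model n)) :
    IsLocalDiffeomorphAt (𝓡 (2 * n)) (𝓡 (2 * n)) ∞ f x := by
  have hchart : IsLocalDiffeomorphAt (𝓡 (2 * n)) (𝓡 (2 * n)) ∞ e x :=
    isLocalDiffeomorphAt_of_eqOn (contMDiffOn_of_mem_maximalAtlas he)
      (contMDiffOn_symm_of_mem_maximalAtlas he) (fun _ _ => rfl) hx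
  have hcoord : IsLocalDiffeomorphAt (𝓡 (2 * n)) (𝓡 (2 * n)) ∞
      (fun y => e' (f (e.symm y))) (e x) :=
    isLocalDiffeomorphAt_of_hasFDerivAt hd
      (hA ▸ (hd.self_of_nhds.differentiableAt (by simp)).hasFDerivAt)
  have hsymm : IsLocalDiffeomorphAt (𝓡 (2 * n)) (𝓡 (2 * n)) ∞ e'.symm
      (e' (f (e.symm (e x)))) :=
    isLocalDiffeomorphAt_of_eqOn (k := e'.symm) (contMDiffOn_symm_of_mem_maximalAtlas he')
      (contMDiffOn_of_mem_maximalAtlas he') (fun _ _ => rfl)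
      (e'.map_source (by rwa [e.left_inv hx]))
  refine isLocalDiffeomorphAt_congr ((hchart.comp _ _ hcoord).comp _ _ hsymm) ?_
  filter_upwards [e.open_source.mem_nhds hx, hf.eventually (e'.open_source.mem_nhds hfx)]
    with z hz hfz
  simp only [Function.comp_apply, e.left_inv hz, e'.left_inv hfz]

theorem surjective_of_isLocalDiffeomorph [T2Space M] [CompactSpace M] {f : M → M}
    (hf : IsLocalDiffeomorph (𝓡 (2 * n)) (𝓡 (2 * n)) ∞ f)
    (hcomp : ∀ x, f x ∈ connectedComponent x) : Function.Surjective f := by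
  have : LocallyConnectedSpace M := ChartedSpace.locallyConnectedSpace (Model n) M
  intro y
  have hclosed : IsClosed (f '' connectedComponent y) :=
    (isClosed_connectedComponent.isCompact.image hf.contMDiff.continuous).isClosed
  have hopen : IsOpen (f '' connectedComponent y) :=
    hf.isOpenMap _ isOpen_connectedComponent
  have hsub : connectedComponent y ⊆ f '' connectedComponent y :=
    isPreconnected_connectedComponent.subset_isClopen ⟨hclosed, hopen⟩
      ⟨f y, hcomp y, Set.mem_image_of_mem f mem_connectedComponent⟩
  obtain ⟨x, -, hx⟩ := hsub mem_connectedComponent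
  exact ⟨x, hx⟩

variable {P : Type*} [TopologicalSpace P] {Φ : P → M → M} {p₀ : P}

theorem fderiv_family_id (hΦ : IsFamilyThroughId (n := n) p₀ Φ) (hx : x ∈ e.source) :
    fderiv ℝ (fun y => e (Φ p₀ (e.symm y))) (e x) = ContinuousLinearMap.id ℝ (Model n) := by
  have h : (fun y => e (Φ p₀ (e.symm y))) =ᶠ[𝓝 (e x)] fun y => y := by
    filter_upwards [e.open_target.mem_nhds (e.map_source hx)] with y hy
    rw [hΦ.1, e.right_inv hy]
  rw [h.fderiv_eq]
  exact fderiv_id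

variable [IsManifold (𝓡 (2 * n)) ∞ M]

theorem eventually_isLocalDiffeomorphAt (hΦ : IsFamilyThroughId (n := n) p₀ Φ) (x : M) :
    ∀ᶠ q : P × M in 𝓝 (p₀, x),
      IsLocalDiffeomorphAt (𝓡 (2 * n)) (𝓡 (2 * n)) ∞ (Φ q.1) q.2 := by
  have he : chartAt (Model n) x ∈ charts n M := IsManifold.chart_mem_maximalAtlas _
  set e := chartAt (Model n) x
  have hx : x ∈ e.source := mem_chart_source _ x
  have hF := (hΦ.2 x).c1FamilyAt he he hx (by rwa [hΦ.1])
  have hinv : ∀ᶠ q : P × Model n in 𝓝 (p₀, e x),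
      fderiv ℝ (fun y => e (Φ q.1 (e.symm y))) q.2 ∈
        Set.range ((↑) : (Model n ≃L[ℝ] Model n) → Model n →L[ℝ] Model n) := by
    refine hF.continuousAt_fderiv.eventually (ContinuousLinearEquiv.isOpen.mem_nhds ?_)
    simp only [fderiv_family_id hΦ hx]
    exact ⟨ContinuousLinearEquiv.refl ℝ _, rfl⟩
  filter_upwards [(tendsto_prod_chart p₀ hx).eventually hinv,
    continuousAt_snd.eventually (e.open_source.mem_nhds hx), (hΦ.2 x).eventually,
    (hΦ.2 x).continuousAt.eventually (e.open_source.mem_nhds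
      (by simpa only [hΦ.1] using hx))] with q ⟨A, hA⟩ hqx hqΦ hΦqx
  have hcont : ContinuousAt (Φ q.1) q.2 :=
    ContinuousAt.comp (f := fun z => (q.1, z)) hqΦ.continuousAt
      (continuousAt_const.prodMk continuousAt_id)
  have hslice : Filter.Tendsto (fun y : Model n => (q.1, y)) (𝓝 (e q.2)) (𝓝 (q.1, e q.2)) :=
    (continuousAt_const.prodMk continuousAt_id).tendsto
  exact isLocalDiffeomorphAt_of_fderiv hcont he he hqx hΦqx
    ((hslice.eventually (hqΦ.c1FamilyAt he he hqx hΦqx).eventually).mono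
      fun y hy => hy.contDiffAt) hA.symm

theorem eventually_eq_of_apply_eq (hΦ : IsFamilyThroughId (n := n) p₀ Φ) (x : M) :
    ∀ᶠ q : P × (M × M) in 𝓝 (p₀, (x, x)), Φ q.1 q.2.1 = Φ q.1 q.2.2 → q.2.1 = q.2.2 := by
  have he : chartAt (Model n) x ∈ charts n M := IsManifold.chart_mem_maximalAtlas _
  set e := chartAt (Model n) x
  have hx : x ∈ e.source := mem_chart_source _ x
  have hF := ((hΦ.2 x).c1FamilyAt he he hx (by rwa [hΦ.1])).eventually_eq_of_apply_eq
    (fderiv_family_id hΦ hx)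
  have hchart : ContinuousAt (fun q : P × (M × M) => (q.1, (e q.2.1, e q.2.2))) (p₀, (x, x)) :=
    continuousAt_fst.prodMk (((e.continuousAt hx).comp_of_eq (by fun_prop) rfl).prodMk
      ((e.continuousAt hx).comp_of_eq (by fun_prop) rfl))
  have hsource : ∀ᶠ a : M × M in 𝓝 (x, x), a.1 ∈ e.source ∧ a.2 ∈ e.source :=
    prod_mem_nhds (e.open_source.mem_nhds hx) (e.open_source.mem_nhds hx)
  filter_upwards [hchart.eventually hF, continuousAt_snd.eventually hsource]
    with q hq ⟨hq₁, hq₂⟩ heq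
  simp only [e.left_inv hq₁, e.left_inv hq₂, heq, forall_const] at hq
  exact e.injOn hq₁ hq₂ hq

variable [T2Space M] [CompactSpace M]

theorem eventually_injective (hΦ : IsFamilyThroughId (n := n) p₀ Φ) :
    ∀ᶠ p in 𝓝 p₀, Function.Injective (Φ p) := by
  suffices h : ∀ᶠ p in 𝓝 p₀, ∀ a ∈ (Set.univ : Set (M × M)), Φ p a.1 = Φ p a.2 → a.1 = a.2 from
    h.mono fun p hp x x' hxx' => hp (x, x') (Set.mem_univ _) hxx'
  refine isCompact_univ.eventually_forall_of_forall_eventually ?_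
  rintro ⟨x, x'⟩ -
  by_cases hxx' : x = x'
  · subst hxx'
    exact eventually_eq_of_apply_eq hΦ x
  · have hpair : ContinuousAt (fun q : P × (M × M) => (Φ q.1 q.2.1, Φ q.1 q.2.2)) (p₀, (x, x')) :=
      (ContinuousAt.comp (x := (p₀, (x, x'))) (f := fun q : P × (M × M) => (q.1, q.2.1))
        (hΦ.2 x).continuousAt (by fun_prop)).prodMk
      (ContinuousAt.comp (x := (p₀, (x, x'))) (f := fun q : P × (M × M) => (q.1, q.2.2))
        (hΦ.2 x').continuousAt (by fun_prop))
    filter_upwards [hpair.eventually (isClosed_diagonal.isOpen_compl.mem_nhds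
      (by
        simp only [hΦ.1]; exact hxx'))] with q hq heq
    exact absurd heq hq

theorem eventually_exists_diffeomorph (hΦ : IsFamilyThroughId (n := n) p₀ Φ) :
    ∀ᶠ p in 𝓝 p₀, ∃ φ : Diff n M, ⇑φ = Φ p := by
  have : LocallyConnectedSpace M := ChartedSpace.locallyConnectedSpace (Model n) M
  have hlocal : ∀ᶠ p in 𝓝 p₀, ∀ x ∈ (Set.univ : Set M),
      IsLocalDiffeomorphAt (𝓡 (2 * n)) (𝓡 (2 * n)) ∞ (Φ p) x ∧ Φ p x ∈ connectedComponent x := by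
    refine isCompact_univ.eventually_forall_of_forall_eventually fun x _ => ?_
    have hcomp : connectedComponent x ∈ 𝓝 x :=
      isOpen_connectedComponent.mem_nhds mem_connectedComponent
    filter_upwards [eventually_isLocalDiffeomorphAt hΦ x,
      (hΦ.2 x).continuousAt.eventually_mem (by rwa [hΦ.1]),
      continuousAt_snd.eventually hcomp] with q hq hΦq hqx
    exact ⟨hq, connectedComponent_eq hqx ▸ hΦq⟩
  filter_upwards [hlocal, eventually_injective hΦ] with p hp hinj
  have hdiffeo : IsLocalDiffeomorph (𝓡 (2 * n)) (𝓡 (2 * n)) ∞ (Φ p) :=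
    fun x => (hp x (Set.mem_univ x)).1
  exact ⟨hdiffeo.diffeomorphOfBijective
    ⟨hinj, surjective_of_isLocalDiffeomorph hdiffeo fun x => (hp x (Set.mem_univ x)).2⟩, rfl⟩

end Diffeo

section DivCoord

variable {n : ℕ} {i : Fin (2 * n)} {f : Model n → ℝ} {y : Model n}

theorem mul_divCoord (h : y i = 0 → f y = 0) : y i * divCoord i f y = f y := by
  unfold divCoord
  split_ifs with hyi
  · rw [hyi, zero_mul, h hyi]
  · field_simp

theorem divCoord_neg (i : Fin (2 * n)) (f : Model n → ℝ) (y : Model n) :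
    divCoord i (fun y => -f y) y = -divCoord i f y := by
  unfold divCoord
  split_ifs
  · rw [fderiv_fun_neg]
    rfl
  · exact neg_div _ _

theorem continuousAt_divCoord_of_ne {X : Type*} [TopologicalSpace X] {f : X → Model n → ℝ} {x : X}
    (hy : y i ≠ 0) (hf : ContinuousAt (fun q : X × Model n => f q.1 q.2) (x, y)) :
    ContinuousAt (fun q : X × Model n => divCoord i (f q.1) q.2) (x, y) := by
  have hcoord : ContinuousAt (fun q : X × Model n => q.2 i) (x, y) := by fun_prop
  refine (hf.div hcoord hy).congr ?_
  filter_upwards [hcoord.eventually_ne hy] with q hq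
  exact (if_neg hq).symm

theorem isLittleO_sub_coord_mul {f' : Model n →L[ℝ] ℝ} (hf : HasStrictFDerivAt f f' y)
    (hyi : y i = 0) (h0 : ∀ᶠ z in 𝓝 y, z i = 0 → f z = 0) :
    (fun z => f z - z i * f' (EuclideanSpace.single i 1)) =o[𝓝 y] fun z => z i := by
  let π : Model n → Model n := fun z => z - z i • EuclideanSpace.single i (1 : ℝ)
  have hπy : π y = y := by simp only [π, hyi, zero_smul, sub_zero]
  have hπ : Filter.Tendsto π (𝓝 y) (𝓝 y) := by
    have hcont : ContinuousAt π y := by fun_prop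
    simpa only [ContinuousAt, hπy] using hcont
  have hstrict := hf.isLittleO.comp_tendsto (Filter.tendsto_id.prodMk_nhds hπ)
  refine (hstrict.norm_right.congr' ?_ (Filter.Eventually.of_forall fun z => ?_)).of_norm_right
  · filter_upwards [hπ.eventually h0] with z hz
    simp [π, hz (by simp [π])]
  · simp [π, norm_smul]

theorem continuousAt_divCoord (hf : ContDiffAt ℝ 1 f y) (h0 : ∀ᶠ z in 𝓝 y, z i = 0 → f z = 0) :
    ContinuousAt (divCoord i f) y := by
  by_cases hyi : y i = 0
  · have hval : divCoord i f y = fderiv ℝ f y (EuclideanSpace.single i 1) := if_pos hyi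
    have hdiv := (isLittleO_sub_coord_mul (hf.hasStrictFDerivAt one_ne_zero) hyi
      h0).tendsto_div_nhds_zero.add_const (fderiv ℝ f y (EuclideanSpace.single i 1))
    rw [zero_add] at hdiv
    rw [ContinuousAt, hval]
    refine Filter.Tendsto.if (((hf.continuousAt_fderiv one_ne_zero).clm_apply
      continuousAt_const).tendsto.mono_left inf_le_left)
      ((hdiv.mono_left inf_le_left).congr' ?_)
    filter_upwards [Filter.mem_inf_of_right (Filter.mem_principal_self _)] with z hz
    field_simp [show z i ≠ 0 from hz]
    ring
  · have hf' : ContinuousAt (fun q : Unit × Model n => f q.2) ((), y) :=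
      ContinuousAt.comp (f := Prod.snd) hf.continuousAt continuousAt_snd
    exact ContinuousAt.comp (f := fun z : Model n => ((), z))
      (continuousAt_divCoord_of_ne (f := fun _ => f) hyi hf')
      (continuousAt_const.prodMk continuousAt_id)

theorem fderiv_coord_mul {β : Model n → ℝ} (hyi : y i = 0) (hβ : ContinuousAt β y)
    (hf : ∀ᶠ z in 𝓝 y, f z = z i * β z) :
    fderiv ℝ f y (EuclideanSpace.single i 1) = β y := by
  let L : Model n →L[ℝ] ℝ := EuclideanSpace.proj i
  have hderiv : HasFDerivAt f (β y • L) y := by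
    rw [hasFDerivAt_iff_isLittleO]
    have hprod : (fun z : Model n => (β z - β y) * L (z - y)) =o[𝓝 y] fun z => (1 : ℝ) * ‖z - y‖ :=
      Asymptotics.IsLittleO.mul_isBigO
        ((Asymptotics.isLittleO_one_iff ℝ).2 (by simpa using hβ.tendsto.sub_const (β y)))
        (L.isBigO_comp _ _).norm_right
    simp only [one_mul] at hprod
    refine hprod.of_norm_right.congr' ?_ Filter.EventuallyEq.rfl
    filter_upwards [hf] with z hz
    rw [hz, hf.self_of_nhds, hyi]
    simp [L, hyi]
    ring
  simp [hderiv.fderiv, L]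

end DivCoord

section ContinuousSymm

theorem continuous_symm_uncurry {X Y Z : Type*} [TopologicalSpace X] [TopologicalSpace Y]
    [CompactSpace Y] [TopologicalSpace Z] [T2Space Z] {F : X → Y ≃ Z}
    (hF : Continuous fun q : X × Y => F q.1 q.2) :
    Continuous fun q : X × Z => (F q.1).symm q.2 := by
  rw [continuous_iff_continuousAt]
  rintro ⟨x, z⟩
  rw [ContinuousAt, (nhds_basis_opens _).tendsto_right_iff]
  rintro V ⟨hxV, hV⟩
  have hne : ∀ᶠ q : X × Z in 𝓝 (x, z), ∀ y ∈ Vᶜ, F q.1 y ≠ q.2 := by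
    refine hV.isClosed_compl.isCompact.eventually_forall_of_forall_eventually fun y hy => ?_
    have hcont : Continuous fun r : (X × Z) × Y => (F r.1.1 r.2, r.1.2) :=
      (hF.comp (f := fun r : (X × Z) × Y => (r.1.1, r.2)) (by fun_prop)).prodMk (by fun_prop)
    have hFxy : F x y ≠ z := by
      rintro rfl
      exact hy (by simpa using hxV)
    exact (hcont.tendsto ((x, z), y)).eventually (isClosed_diagonal.isOpen_compl.mem_nhds hFxy)
  filter_upwards [hne] with q hq
  by_contra hqV
  exact hq _ hqV ((F q.1).apply_symm_apply q.2)

end ContinuousSymm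

section MatchingFamily

variable {n : ℕ} {M : Type*} [TopologicalSpace M] [ChartedSpace (Model n) M]
  {P : Type*} [TopologicalSpace P] {w₀ : BivectorField n M} {w : P → BivectorField n M}

/-- Near `(p, x)`, the function `⋀ⁿ w₀ ∘ Φ p` is, in local trivializations, a multiple of
`⋀ⁿ (w p)` by a nowhere vanishing factor, continuous in the `C¹`-topology. -/
def IsProportionalAt (w₀ : BivectorField n M) (w : P → BivectorField n M) (Φ : P → M → M) (p : P)
    (x : M) : Prop :=
  ∃ e' ∈ charts n M, ∃ e ∈ charts n M, x ∈ e'.source ∧ Φ p x ∈ e.source ∧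
    ∃ r ≠ 0, HasWedgePowRatioAt w₀ w Φ e' e r p x

/-- A family of diffeomorphisms, continuous in the `C¹`-topology, along which `⋀ⁿ w₀` pulls back
to a nowhere vanishing multiple of `⋀ⁿ (w p)`. -/
structure IsMatchingFamily (w₀ : BivectorField n M) (w : P → BivectorField n M)
    (φ : P → Diff n M) : Prop where
  c1MapFamilyAt : ∀ p x, C1MapFamilyAt (n := n) (fun p => φ p) p x
  isProportionalAt : ∀ p x, IsProportionalAt w₀ w (fun p => φ p) p x

namespace IsProportionalAt

variable {Φ : P → M → M} {p : P} {x : M}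

theorem mem_singularLocus_iff (h : IsProportionalAt w₀ w Φ p x) :
    Φ p x ∈ w₀.singularLocus ↔ x ∈ (w p).singularLocus := by
  obtain ⟨e', he', e, he, hx, hΦx, r, hr, c, -, rfl, hratio⟩ := h
  have hx_ratio := hratio.self_of_nhds
  simp only [e'.left_inv hx] at hx_ratio
  rw [LogSymp.mem_singularLocus_iff he w₀ hΦx, LogSymp.mem_singularLocus_iff he' (w p) hx,
    hx_ratio, mul_eq_zero, or_iff_right hr]

theorem exists_hasWedgePowRatioAt (h : IsProportionalAt w₀ w Φ p x)
    (hΦ : C1MapFamilyAt (n := n) Φ p x) {e' e : OpenPartialHomeomorph M (Model n)}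
    (he' : e' ∈ charts n M) (he : e ∈ charts n M) (hx : x ∈ e'.source) (hΦx : Φ p x ∈ e.source) :
    ∃ r ≠ 0, HasWedgePowRatioAt w₀ w Φ e' e r p x := by
  obtain ⟨e₁', he₁', e₁, he₁, hx₁, hΦx₁, r, hr, hratio⟩ := h
  have hsource := left_ne_zero_of_mul_eq_one (det_jacobian_transition_mul he' he₁' hx hx₁)
  have htarget := left_ne_zero_of_mul_eq_one (det_jacobian_transition_mul he₁ he hΦx₁ hΦx)
  exact ⟨_, mul_ne_zero (mul_ne_zero htarget hr) hsource,
    (hratio.change_target hΦ he₁ he₁' he hx₁ hΦx₁ hΦx).change_source he₁' he' hx₁ hx⟩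

theorem comp_param {Q : Type*} [TopologicalSpace Q] {g : Q → P} {q : Q}
    (h : IsProportionalAt w₀ w Φ (g q) x) (hg : Continuous g) :
    IsProportionalAt w₀ (fun q => w (g q)) (fun q => Φ (g q)) q x := by
  obtain ⟨e', he', e, he, hx, hΦx, r, hr, hratio⟩ := h
  exact ⟨e', he', e, he, hx, hΦx, r, hr, hratio.comp_param hg⟩

end IsProportionalAt

section Existence

variable {p₀ : P} {Φ : P → M → M}

theorem MatchesAt.eventually_isProportionalAt {x : M} (h : MatchesAt w p₀ Φ x)
    (hΦ : IsFamilyThroughId (n := n) p₀ Φ) :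
    ∀ᶠ q : P × M in 𝓝 (p₀, x), IsProportionalAt (w p₀) w Φ q.1 q.2 := by
  obtain ⟨e, he, hx, hratio⟩ := h
  have hΦx : Φ p₀ x ∈ e.source := by rwa [hΦ.1]
  filter_upwards [hratio.eventually one_ne_zero hx,
    continuousAt_snd.eventually (e.open_source.mem_nhds hx),
    (hΦ.2 x).continuousAt.eventually (e.open_source.mem_nhds hΦx)] with q hqr hqx hqΦ
  exact ⟨e, he, e, he, hqx, hqΦ, hqr⟩

variable [IsManifold (𝓡 (2 * n)) ∞ M]

theorem matchesAt_of_notMem_singularLocus (hw : Continuous w)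
    (hΦ : IsFamilyThroughId (n := n) p₀ Φ) {x : M} (hx : x ∉ (w p₀).singularLocus) :
    MatchesAt w p₀ Φ x := by
  have he : chartAt (Model n) x ∈ charts n M := IsManifold.chart_mem_maximalAtlas _
  set e := chartAt (Model n) x
  have hxe : x ∈ e.source := mem_chart_source _ x
  have hΦx : Φ p₀ x ∈ e.source := by rwa [hΦ.1]
  have hne : (w p₀).wedgePowComponent e (e x) ≠ 0 :=
    fun h0 => hx ((mem_singularLocus_iff he _ hxe).2 h0)
  have hdenom := c1FamilyAt_wedgePowComponent hw he p₀ (e.map_source hxe)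
  have hnum : C1FamilyAt (fun p y => (w p₀).wedgePowComponent e (e (Φ p (e.symm y)))) p₀ (e x) :=
    C1FamilyAt.comp (g := fun _ => (w p₀).wedgePowComponent e)
      (c1FamilyAt_wedgePowComponent continuous_const he p₀
        (e.map_source (by rwa [e.left_inv hxe])))
      ((hΦ.2 x).c1FamilyAt he he hxe hΦx)
  refine ⟨e, he, hxe, _, hnum.div hdenom hne, ?_, ?_⟩
  · rw [e.left_inv hxe, hΦ.1, div_self hne]
  · filter_upwards [hdenom.continuousAt.eventually_ne hne] with q hq
    exact (div_mul_cancel₀ _ hq).symm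

theorem exists_isMatchingFamily [T2Space M] [CompactSpace M] (hw : Continuous w)
    (hp₀ : (w p₀).WedgePowTransverse) :
    ∃ (V : Set P) (hV : p₀ ∈ V) (φ : V → Diff n M), IsOpen V ∧
      φ ⟨p₀, hV⟩ = Diffeomorph.refl (𝓡 (2 * n)) M ∞ ∧
      IsMatchingFamily (w p₀) (fun v : V => w v) φ := by
  obtain ⟨Φ, hΦ, hmatch⟩ := exists_isFamilyThroughId_matchesAt hw hp₀
  have hnear : ∀ᶠ p in 𝓝 p₀, ∀ x ∈ (Set.univ : Set M),
      C1MapFamilyAt (n := n) Φ p x ∧ IsProportionalAt (w p₀) w Φ p x := by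
    refine isCompact_univ.eventually_forall_of_forall_eventually fun x _ => ?_
    have hx : MatchesAt w p₀ Φ x := by
      by_cases hxZ : x ∈ (w p₀).singularLocus
      exacts [hmatch x hxZ, matchesAt_of_notMem_singularLocus hw hΦ hxZ]
    exact (hΦ.2 x).eventually.and (hx.eventually_isProportionalAt hΦ)
  obtain ⟨V, hVsub, hVopen, hpV⟩ :=
    mem_nhds_iff.1 (hnear.and (eventually_exists_diffeomorph hΦ))
  choose φ hφ using fun v : V => (hVsub v.2).2
  have hφΦ : (fun v : V => ⇑(φ v)) = fun v : V => Φ v := funext hφ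
  refine ⟨V, hpV, φ, hVopen, Diffeomorph.ext fun x => ?_, ⟨fun v x => ?_, fun v x => ?_⟩⟩
  · rw [hφ]
    exact hΦ.1 x
  · rw [hφΦ]
    exact ((hVsub v.2).1 x (Set.mem_univ x)).1.comp_param continuous_subtype_val
  · rw [hφΦ]
    exact ((hVsub v.2).1 x (Set.mem_univ x)).2.comp_param continuous_subtype_val

end Existence

namespace IsMatchingFamily

variable {φ : P → Diff n M}

theorem image_singularLocus (h : IsMatchingFamily w₀ w φ) (p : P) :
    φ p '' (w p).singularLocus = w₀.singularLocus := by
  ext z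
  obtain ⟨x, rfl⟩ : ∃ x, φ p x = z := (φ p).surjective z
  rw [Function.Injective.mem_set_image (f := φ p) (φ p).injective,
    (h.isProportionalAt p x).mem_singularLocus_iff]

theorem singularLocus_pushforward [IsManifold (𝓡 (2 * n)) ∞ M] (h : IsMatchingFamily w₀ w φ)
    (p : P) : (pushforward (φ p) (w p)).singularLocus = w₀.singularLocus := by
  ext z
  obtain ⟨x, rfl⟩ : ∃ x, φ p x = z := (φ p).surjective z
  rw [mem_singularLocus_pushforward, (h.isProportionalAt p x).mem_singularLocus_iff]

theorem wedgePowTransverse [IsManifold (𝓡 (2 * n)) ∞ M] (h : IsMatchingFamily w₀ w φ)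
    (hw₀ : w₀.WedgePowTransverse) (p : P) : (w p).WedgePowTransverse := by
  rw [wedgePowTransverse_iff] at hw₀ ⊢
  intro e' he' y hy hy0 hdy
  -- In the chart `e' ∘ (φ p)⁻¹`, the map `φ p` is the identity.
  set e := pullChart (φ p).symm e'
  have he : e ∈ charts n M := pullChart_mem_charts (φ p).symm he'
  have hφ (z : M) : e (φ p z) = e' z := by rw [pullChart_apply, (φ p).symm_apply_apply]
  have hx : e'.symm y ∈ e'.source := e'.map_target hy
  have hφx : φ p (e'.symm y) ∈ e.source := by
    rwa [pullChart_source, Set.mem_preimage, (φ p).symm_apply_apply]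
  obtain ⟨r, -, c, hc, -, hratio⟩ := (h.isProportionalAt p (e'.symm y)).exists_hasWedgePowRatioAt
    (h.c1MapFamilyAt p _) he' he hx hφx
  rw [e'.right_inv hy] at hc hratio
  have hslice : w₀.wedgePowComponent e =ᶠ[𝓝 y]
      fun u => c p u * (w p).wedgePowComponent e' u := by
    have hcont : ContinuousAt (fun u : Model n => (p, u)) y := by fun_prop
    filter_upwards [hcont.eventually hratio, e'.open_target.mem_nhds hy] with u hu hut
    simpa only [hφ, e'.right_inv hut] using hu
  refine hw₀ e he y hy (hslice.eq_of_nhds.trans (by simp only [hy0, mul_zero])) ?_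
  rw [hslice.fderiv_eq, fderiv_fun_mul hc.differentiableAt
    ((contDiffAt_wedgePowComponent (w p) he' hy).differentiableAt (by simp)), hy0, hdy,
    smul_zero, zero_smul, add_zero]

end IsMatchingFamily

end MatchingFamily

/-! ### Continuity of the push-forward -/

section PushforwardComponent

variable {n : ℕ} {M : Type*} [TopologicalSpace M] [ChartedSpace (Model n) M]
  {P : Type*} [TopologicalSpace P] {w : P → BivectorField n M} {Φ : P → M → M}
  {e e' : OpenPartialHomeomorph M (Model n)} {p : P} {x : M}

namespace C1FamilyAt

theorem continuousAt_partialDeriv {f : P → Model n → ℝ} {y : Model n} (hf : C1FamilyAt f p y)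
    (a : Fin (2 * n)) : ContinuousAt (fun q : P × Model n => partialDeriv a (f q.1) q.2) (p, y) :=
  hf.continuousAt_fderiv.clm_apply continuousAt_const

theorem continuousAt_jacobian {F : P → Model n → Model n} {y : Model n} (hF : C1FamilyAt F p y)
    (j a : Fin (2 * n)) :
    ContinuousAt (fun q : P × Model n => jacobian (F q.1) q.2 j a) (p, y) :=
  (C1FamilyAt.contDiff_comp (EuclideanSpace.proj j : Model n →L[ℝ] ℝ).contDiff
    hF).continuousAt_partialDeriv a

end C1FamilyAt

/-- The components in the chart `e` of the push-forward of `w q.1` by `Φ q.1`, at the image of the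
point with coordinates `q.2` in the chart `e'`. -/
def pushforwardComponent (w : P → BivectorField n M) (Φ : P → M → M)
    (e' e : OpenPartialHomeomorph M (Model n)) (j k : Fin (2 * n)) (q : P × Model n) : ℝ :=
  ∑ a, ∑ b, jacobian (fun u => e (Φ q.1 (e'.symm u))) q.2 j a *
    jacobian (fun u => e (Φ q.1 (e'.symm u))) q.2 k b * component (w q.1).toFun e' a b q.2

omit [TopologicalSpace P] in
theorem component_pushforward_eq_pushforwardComponent [IsManifold (𝓡 (2 * n)) ∞ M]
    (φ : P → Diff n M) (he' : e' ∈ charts n M) (he : e ∈ charts n M) {y : Model n}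
    (hy : y ∈ e.target) (hx : (φ p).symm (e.symm y) ∈ e'.source) (j k : Fin (2 * n)) :
    component (pushforward (φ p) (w p)).toFun e j k y =
      pushforwardComponent w (fun p => φ p) e' e j k (p, e' ((φ p).symm (e.symm y))) := by
  have hx' : (φ p).symm (e.symm y) ∈ (pullChart (φ p) e).source := by
    rw [pullChart_source, Set.mem_preimage, (φ p).apply_symm_apply]
    exact e.map_target hy
  have hchange := component_change he' (pullChart_mem_charts (φ p) he) (w p).toFun hx hx' j k
  simp only [pullChart_apply, (φ p).apply_symm_apply, e.right_inv hy] at hchange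
  rw [component_pushforward, hchange]
  rfl

theorem continuousAt_pushforwardComponent (hw : Continuous w)
    (hΦ : C1MapFamilyAt (n := n) Φ p x) (he' : e' ∈ charts n M) (he : e ∈ charts n M)
    (hx : x ∈ e'.source) (hΦx : Φ p x ∈ e.source) (j k : Fin (2 * n)) :
    ContinuousAt (pushforwardComponent w Φ e' e j k) (p, e' x) := by
  have hF := hΦ.c1FamilyAt he' he hx hΦx
  refine tendsto_finsetSum _ fun a _ => tendsto_finsetSum _ fun b _ => ?_
  exact ((hF.continuousAt_jacobian j a).mul (hF.continuousAt_jacobian k b)).mul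
    (c1FamilyAt_component hw he' p (e'.map_source hx) a b).continuousAt

omit [TopologicalSpace P] in
theorem sum_partialDeriv_mul_pushforwardComponent {u : Model n} {f : Model n → ℝ}
    (hF : DifferentiableAt ℝ (fun u => e (Φ p (e'.symm u))) u)
    (hf : DifferentiableAt ℝ f (e (Φ p (e'.symm u)))) (k : Fin (2 * n)) :
    ∑ j, partialDeriv j f (e (Φ p (e'.symm u))) * pushforwardComponent w Φ e' e j k (p, u) =
      ∑ b, jacobian (fun u => e (Φ p (e'.symm u))) u k b * ∑ a,
        component (w p).toFun e' a b u * partialDeriv a (fun u => f (e (Φ p (e'.symm u)))) u := by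
  simp only [pushforwardComponent, partialDeriv_comp (F := fun u => e (Φ p (e'.symm u))) hF hf,
    Finset.mul_sum]
  rw [Finset.sum_comm_cycle]
  refine Finset.sum_congr rfl fun b _ => ?_
  rw [Finset.sum_comm]
  exact Finset.sum_congr rfl fun a _ => Finset.sum_congr rfl fun j _ => by ring

end PushforwardComponent

section LogHamiltonian

variable {n : ℕ} {M : Type*} [TopologicalSpace M] [ChartedSpace (Model n) M]
  {e : OpenPartialHomeomorph M (Model n)}

/-- The `b`-th component, in the chart `e`, of the Hamiltonian vector field of `log |c ⋀ⁿ w|`, for a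
Poisson structure `w` and a nowhere vanishing `c`. It is written in a form that also makes sense on
the singular locus and involves only first derivatives of `w`. -/
def logHamiltonian (w : BivectorField n M) (e : OpenPartialHomeomorph M (Model n))
    (c : Model n → ℝ) (b : Fin (2 * n)) (y : Model n) : ℝ :=
  (∑ a, component w.toFun e a b y * partialDeriv a c y) / c y +
    ∑ a, partialDeriv a (component w.toFun e a b) y

theorem sum_component_mul_partialDeriv_mul_wedgePowComponent [T2Space M]
    [IsManifold (𝓡 (2 * n)) ∞ M] {w : BivectorField n M} (hw : w.IsPoisson) (he : e ∈ charts n M)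
    {y : Model n} (hy : y ∈ e.target) {c : Model n → ℝ} (hc : DifferentiableAt ℝ c y)
    (hcy : c y ≠ 0) (b : Fin (2 * n)) :
    ∑ a, component w.toFun e a b y * partialDeriv a (fun y => c y * w.wedgePowComponent e y) y =
      c y * w.wedgePowComponent e y * logHamiltonian w e c b y := by
  have hleibniz (a) : partialDeriv a (fun y => c y * w.wedgePowComponent e y) y =
      partialDeriv a c y * w.wedgePowComponent e y +
        c y * partialDeriv a (w.wedgePowComponent e) y := by
    rw [partialDeriv, fderiv_fun_mul hc
      ((contDiffAt_wedgePowComponent w he hy).differentiableAt (by simp))]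
    simp only [partialDeriv, _root_.add_apply, _root_.smul_apply, smul_eq_mul]
    ring
  calc _ = w.wedgePowComponent e y * ∑ a, component w.toFun e a b y * partialDeriv a c y +
        c y * ∑ a, component w.toFun e a b y * partialDeriv a (w.wedgePowComponent e) y := by
        simp only [hleibniz, Finset.mul_sum, ← Finset.sum_add_distrib]
        exact Finset.sum_congr rfl fun a _ => by ring
    _ = c y * w.wedgePowComponent e y * logHamiltonian w e c b y := by
        rw [sum_component_mul_partialDeriv_wedgePowComponent hw he hy b, logHamiltonian]
        field_simp

theorem continuousAt_logHamiltonian {P : Type*} [TopologicalSpace P] {w : P → BivectorField n M}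
    (hw : Continuous w) (he : e ∈ charts n M) {c : P → Model n → ℝ} {p : P} {y : Model n}
    (hy : y ∈ e.target) (hc : C1FamilyAt c p y) (hcy : c p y ≠ 0) (b : Fin (2 * n)) :
    ContinuousAt (fun q : P × Model n => logHamiltonian (w q.1) e (c q.1) b q.2) (p, y) := by
  have hcomp (a) := c1FamilyAt_component hw he p hy a b
  exact ((tendsto_finsetSum _ fun a _ => (hcomp a).continuousAt.mul
    (hc.continuousAt_partialDeriv a)).div hc.continuousAt hcy).add
    (tendsto_finsetSum _ fun a _ => (hcomp a).continuousAt_partialDeriv a)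

end LogHamiltonian

section NormalQuotient

variable {n : ℕ} {i : Fin (2 * n)} {f : Model n → ℝ} {y : Model n}

theorem partialDeriv_eq_zero_of_eventually {j : Fin (2 * n)} (hji : j ≠ i)
    (hf : DifferentiableAt ℝ f y) (h0 : ∀ᶠ z in 𝓝 y, z i = 0 → f z = 0) (hyi : y i = 0) :
    partialDeriv j f y = 0 := by
  have hline : HasDerivAt (fun t : ℝ => f (y + t • EuclideanSpace.single j (1 : ℝ)))
      (partialDeriv j f y) 0 := hf.hasFDerivAt.hasLineDerivAt _
  refine hline.unique ((hasDerivAt_const (0 : ℝ) (0 : ℝ)).congr_of_eventuallyEq ?_)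
  have hcont : Filter.Tendsto (fun t : ℝ => y + t • EuclideanSpace.single j (1 : ℝ)) (𝓝 0)
      (𝓝 y) := by
    have h : ContinuousAt (fun t : ℝ => y + t • EuclideanSpace.single j (1 : ℝ)) 0 := by fun_prop
    simpa only [ContinuousAt, zero_smul, add_zero] using h
  filter_upwards [hcont.eventually h0] with t ht
  exact ht (by simp [hyi, hji.symm])

theorem partialDeriv_ne_zero_of_fderiv_ne_zero (hf : DifferentiableAt ℝ f y)
    (h0 : ∀ᶠ z in 𝓝 y, z i = 0 → f z = 0) (hyi : y i = 0) (hdf : fderiv ℝ f y ≠ 0) :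
    partialDeriv i f y ≠ 0 := by
  refine fun hi => hdf (ContinuousLinearMap.ext fun v => ?_)
  rw [fderiv_apply_eq_sum_partialDeriv]
  refine Finset.sum_eq_zero fun j _ => ?_
  by_cases hji : j = i
  · rw [hji, hi, zero_mul]
  · rw [partialDeriv_eq_zero_of_eventually hji hf h0 hyi, zero_mul]

/-- The quotient of the normal component `v i` of a vector `v` by `y i`, computed from `df(v) / f`
(denoted `E`) and the tangential components of `v`, for a function `f` that vanishes on
`{y_i = 0}`. -/
def normalQuotient (i : Fin (2 * n)) (f : Model n → ℝ) (y : Model n) (v : Fin (2 * n) → ℝ)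
    (E : ℝ) : ℝ :=
  (divCoord i f y * E - ∑ j ∈ Finset.univ.erase i, divCoord i (partialDeriv j f) y * v j) /
    partialDeriv i f y

theorem eq_coord_mul_normalQuotient {v : Fin (2 * n) → ℝ} {E : ℝ} (hf : DifferentiableAt ℝ f y)
    (h0 : ∀ᶠ z in 𝓝 y, z i = 0 → f z = 0) (hi : partialDeriv i f y ≠ 0)
    (hE : ∑ j, partialDeriv j f y * v j = f y * E) : v i = y i * normalQuotient i f y v E := by
  have htangential : ∑ j ∈ Finset.univ.erase i, partialDeriv j f y * v j =
      y i * ∑ j ∈ Finset.univ.erase i, divCoord i (partialDeriv j f) y * v j := by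
    rw [Finset.mul_sum]
    refine Finset.sum_congr rfl fun j hj => ?_
    rw [← mul_assoc, mul_divCoord fun hyi =>
      partialDeriv_eq_zero_of_eventually (Finset.ne_of_mem_erase hj) hf h0 hyi]
  rw [← Finset.add_sum_erase _ _ (Finset.mem_univ i), htangential,
    ← mul_divCoord h0.self_of_nhds] at hE
  rw [normalQuotient, mul_div_assoc', eq_div_iff hi]
  linear_combination hE

theorem continuousAt_normalQuotient {X : Type*} [TopologicalSpace X] {Y : X → Model n}
    {v : Fin (2 * n) → X → ℝ} {E : X → ℝ} {x : X} (hY : ContinuousAt Y x)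
    (hv : ∀ j, ContinuousAt (v j) x) (hE : ContinuousAt E x) (hf : ContDiffAt ℝ ∞ f (Y x))
    (h0 : ∀ᶠ z in 𝓝 (Y x), z i = 0 → f z = 0) (hi : partialDeriv i f (Y x) ≠ 0) :
    ContinuousAt (fun x => normalQuotient i f (Y x) (fun j => v j x) (E x)) x := by
  have hpartial (j) : ContDiffAt ℝ 1 (partialDeriv j f) (Y x) :=
    (hf.fderiv_right (m := 1) (by norm_cast)).clm_apply contDiffAt_const
  have hpartial0 (j) (hj : j ≠ i) : ∀ᶠ z in 𝓝 (Y x), z i = 0 → partialDeriv j f z = 0 := by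
    filter_upwards [(hf.of_le (m := 1) (by norm_cast)).eventually (by simp), h0.eventually_nhds]
      with z hz hz0 using partialDeriv_eq_zero_of_eventually hj (hz.differentiableAt (by simp)) hz0
  refine (((ContinuousAt.comp (f := Y)
    (continuousAt_divCoord (hf.of_le (by norm_cast)) h0) hY).mul hE).sub
    (tendsto_finsetSum _ fun j hj => ?_)).div
    (ContinuousAt.comp (f := Y) (hpartial i).continuousAt hY) hi
  exact (ContinuousAt.comp (f := Y)
    (continuousAt_divCoord (hpartial j) (hpartial0 j (Finset.ne_of_mem_erase hj))) hY).mul (hv j)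

end NormalQuotient

section Tangency

variable {n : ℕ} {M : Type*} [TopologicalSpace M] [ChartedSpace (Model n) M]
  {P : Type*} [TopologicalSpace P] {w₀ : BivectorField n M} {w : P → BivectorField n M}
  {Φ : P → M → M} {e' e : OpenPartialHomeomorph M (Model n)} {i : Fin (2 * n)} {p : P}

section Adapted

variable {y : Model n}

theorem wedgePowComponent_eq_zero_iff_of_isAdapted (he : IsAdapted w₀.singularLocus e i)
    (hy : y ∈ e.target) : w₀.wedgePowComponent e y = 0 ↔ y i = 0 := by
  have hlocus := mem_singularLocus_iff he.1 w₀ (e.map_target hy)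
  have hcoord := he.2 _ (e.map_target hy)
  rw [e.right_inv hy] at hlocus hcoord
  exact hlocus.symm.trans hcoord

theorem eventually_wedgePowComponent_eq_zero (he : IsAdapted w₀.singularLocus e i)
    (hy : y ∈ e.target) : ∀ᶠ z in 𝓝 y, z i = 0 → w₀.wedgePowComponent e z = 0 := by
  filter_upwards [e.open_target.mem_nhds hy] with z hz
  exact (wedgePowComponent_eq_zero_iff_of_isAdapted he hz).2

theorem partialDeriv_wedgePowComponent_ne_zero [IsManifold (𝓡 (2 * n)) ∞ M]
    (hw₀ : w₀.WedgePowTransverse) (he : IsAdapted w₀.singularLocus e i) (hy : y ∈ e.target)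
    (hyi : y i = 0) :
    partialDeriv i (w₀.wedgePowComponent e) y ≠ 0 :=
  partialDeriv_ne_zero_of_fderiv_ne_zero
    ((contDiffAt_wedgePowComponent w₀ he.1 hy).differentiableAt (by simp))
    (eventually_wedgePowComponent_eq_zero he hy) hyi
    ((wedgePowTransverse_iff w₀).1 hw₀ e he.1 y hy
      ((wedgePowComponent_eq_zero_iff_of_isAdapted he hy).2 hyi))

end Adapted

/-- The quotient of `pushforwardComponent w Φ e' e i k` by the `i`-th coordinate of the image point,
where `e` is a chart in which the singular locus of `w₀` is `{y_i = 0}` and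
`⋀ⁿ w₀ ∘ Φ p = c p * ⋀ⁿ (w p)` in the charts `e` and `e'`. -/
def pushforwardQuotient (w₀ : BivectorField n M) (w : P → BivectorField n M) (Φ : P → M → M)
    (c : P → Model n → ℝ) (e' e : OpenPartialHomeomorph M (Model n)) (i k : Fin (2 * n))
    (q : P × Model n) : ℝ :=
  normalQuotient i (w₀.wedgePowComponent e) (e (Φ q.1 (e'.symm q.2)))
    (fun j => pushforwardComponent w Φ e' e j k q)
    (∑ b, jacobian (fun u => e (Φ q.1 (e'.symm u))) q.2 k b *
      logHamiltonian (w q.1) e' (c q.1) b q.2)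

variable {c : P → Model n → ℝ} {u : Model n}

omit [TopologicalSpace P] in
theorem pushforwardComponent_eq_coord_mul [T2Space M] [IsManifold (𝓡 (2 * n)) ∞ M]
    (hp : (w p).IsPoisson) (he' : e' ∈ charts n M) (he : IsAdapted w₀.singularLocus e i)
    (hu : u ∈ e'.target) (hy : e (Φ p (e'.symm u)) ∈ e.target)
    (hF : DifferentiableAt ℝ (fun u => e (Φ p (e'.symm u))) u) (hc : DifferentiableAt ℝ (c p) u)
    (hcu : c p u ≠ 0)
    (hi : partialDeriv i (w₀.wedgePowComponent e) (e (Φ p (e'.symm u))) ≠ 0)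
    (hratio : ∀ᶠ u in 𝓝 u, w₀.wedgePowComponent e (e (Φ p (e'.symm u))) =
      c p u * (w p).wedgePowComponent e' u) (k : Fin (2 * n)) :
    pushforwardComponent w Φ e' e i k (p, u) =
      e (Φ p (e'.symm u)) i * pushforwardQuotient w₀ w Φ c e' e i k (p, u) := by
  have hf : DifferentiableAt ℝ (w₀.wedgePowComponent e) (e (Φ p (e'.symm u))) :=
    (contDiffAt_wedgePowComponent w₀ he.1 hy).differentiableAt (by simp)
  refine eq_coord_mul_normalQuotient (v := fun j => pushforwardComponent w Φ e' e j k (p, u)) hf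
    (eventually_wedgePowComponent_eq_zero he hy) hi ?_
  have hpartial (a) : partialDeriv a (fun u => w₀.wedgePowComponent e (e (Φ p (e'.symm u)))) u =
      partialDeriv a (fun u => c p u * (w p).wedgePowComponent e' u) u := by
    rw [partialDeriv, partialDeriv, Filter.EventuallyEq.fderiv_eq hratio]
  simp only [sum_partialDeriv_mul_pushforwardComponent hF hf, hpartial,
    sum_component_mul_partialDeriv_mul_wedgePowComponent hp he' hu hc hcu,
    hratio.self_of_nhds, Finset.mul_sum]
  exact Finset.sum_congr rfl fun b _ => by ring

theorem continuousAt_pushforwardQuotient (hw : Continuous w) (he' : e' ∈ charts n M)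
    (he : IsAdapted w₀.singularLocus e i) {x : M} (hx : x ∈ e'.source) (hΦx : Φ p x ∈ e.source)
    (hΦ : C1MapFamilyAt (n := n) Φ p x) (hc : C1FamilyAt c p (e' x)) (hcx : c p (e' x) ≠ 0)
    (hi : partialDeriv i (w₀.wedgePowComponent e) (e (Φ p x)) ≠ 0) (k : Fin (2 * n)) :
    ContinuousAt (pushforwardQuotient w₀ w Φ c e' e i k) (p, e' x) := by
  have hF := hΦ.c1FamilyAt he' he.1 hx hΦx
  have hy := e.map_source hΦx
  have hbase : e (Φ p (e'.symm (e' x))) = e (Φ p x) := by rw [e'.left_inv hx]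
  refine continuousAt_normalQuotient hF.continuousAt
    (fun j => continuousAt_pushforwardComponent hw hΦ he' he.1 hx hΦx j k)
    (tendsto_finsetSum _ fun b _ => (hF.continuousAt_jacobian k b).mul
      (continuousAt_logHamiltonian hw he' (e'.map_source hx) hc hcx b)) ?_ ?_ ?_
  · rw [hbase]
    exact contDiffAt_wedgePowComponent w₀ he.1 hy
  · rw [hbase]
    exact eventually_wedgePowComponent_eq_zero he hy
  · rwa [hbase]

theorem exists_pushforwardComponent_eq_coord_mul [T2Space M] [IsManifold (𝓡 (2 * n)) ∞ M]
    (hw : Continuous w) (hP : ∀ p, (w p).IsPoisson) (hw₀ : w₀.WedgePowTransverse)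
    (he' : e' ∈ charts n M) (he : IsAdapted w₀.singularLocus e i)
    {x : M} (hx : x ∈ e'.source) (hΦx : Φ p x ∈ e.source) (hi : e (Φ p x) i = 0)
    (hΦ : C1MapFamilyAt (n := n) Φ p x) {r : ℝ} (hr : r ≠ 0)
    (hratio : HasWedgePowRatioAt w₀ w Φ e' e r p x) (k : Fin (2 * n)) :
    ∃ β : P × Model n → ℝ, ∀ᶠ q in 𝓝 (p, e' x), ContinuousAt β q ∧
      pushforwardComponent w Φ e' e i k q = e (Φ q.1 (e'.symm q.2)) i * β q := by
  obtain ⟨c, hc, rfl, hratio⟩ := hratio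
  have hF := hΦ.c1FamilyAt he' he.1 hx hΦx
  have hy := e.map_source hΦx
  have hderiv : ContinuousAt (fun q : P × Model n =>
      partialDeriv i (w₀.wedgePowComponent e) (e (Φ q.1 (e'.symm q.2)))) (p, e' x) := by
    refine ContinuousAt.comp (f := fun q : P × Model n => e (Φ q.1 (e'.symm q.2)))
      (g := partialDeriv i (w₀.wedgePowComponent e)) ?_ hF.continuousAt
    simp only [e'.left_inv hx]
    exact (((contDiffAt_wedgePowComponent w₀ he.1 hy).fderiv_right (m := 1)
      (by norm_cast)).clm_apply contDiffAt_const).continuousAt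
  have hderiv_ne : partialDeriv i (w₀.wedgePowComponent e) (e (Φ p (e'.symm (e' x)))) ≠ 0 := by
    rw [e'.left_inv hx]
    exact partialDeriv_wedgePowComponent_ne_zero hw₀ he hy hi
  refine ⟨pushforwardQuotient w₀ w Φ c e' e i k, ?_⟩
  filter_upwards [hF.eventually, hc.eventually, hc.continuousAt.eventually_ne hr,
    hratio.eventually_nhds, hderiv.eventually_ne hderiv_ne,
    continuousAt_snd.eventually (e'.open_target.mem_nhds (e'.map_source hx)),
    (tendsto_prod_symm p hx).eventually (hΦ.eventually.and
      (hΦ.continuousAt.eventually (e.open_source.mem_nhds hΦx)))]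
    with ⟨p, u⟩ hF hc hcu hratio hi hu ⟨hΦ, hΦu⟩
  have hu' : e' (e'.symm u) = u := e'.right_inv hu
  constructor
  · have hcont := continuousAt_pushforwardQuotient hw he' he (e'.map_target hu) hΦu hΦ
      (by rwa [hu']) (by rwa [hu']) hi k
    rwa [hu'] at hcont
  · have hslice : ContinuousAt (fun u : Model n => (p, u)) u := by fun_prop
    exact pushforwardComponent_eq_coord_mul (hP p) he' he hu (e.map_source hΦu)
      hF.differentiableAt hc.differentiableAt hcu hi (hslice.eventually hratio) k

end Tangency

section LogFamily

variable {n : ℕ} {M : Type*} [TopologicalSpace M] [ChartedSpace (Model n) M]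
  {P : Type*} [TopologicalSpace P] {w₀ : BivectorField n M} {w : P → BivectorField n M}
  {φ : P → Diff n M} {e e' : OpenPartialHomeomorph M (Model n)} {i : Fin (2 * n)}
  {q : P × Model n}

/-- The point of `M` that `φ q.1` maps to the point with coordinates `q.2` in the chart `e`. -/
def preimagePoint (φ : P → Diff n M) (e : OpenPartialHomeomorph M (Model n)) (q : P × Model n) :
    M :=
  (φ q.1).symm (e.symm q.2)

omit [TopologicalSpace P] in
theorem apply_preimagePoint (φ : P → Diff n M) (e : OpenPartialHomeomorph M (Model n))
    (q : P × Model n) : φ q.1 (preimagePoint φ e q) = e.symm q.2 :=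
  (φ q.1).apply_symm_apply _

namespace IsMatchingFamily

variable [T2Space M] [CompactSpace M]

theorem continuousAt_preimagePoint (h : IsMatchingFamily w₀ w φ) (hq : q.2 ∈ e.target) :
    ContinuousAt (preimagePoint φ e) q := by
  have hφ : Continuous fun r : P × M => (φ r.1).toEquiv r.2 :=
    continuous_iff_continuousAt.2 fun r => (h.c1MapFamilyAt r.1 r.2).continuousAt
  have hsymm : ContinuousAt (fun r : P × Model n => (r.1, e.symm r.2)) q :=
    continuousAt_fst.prodMk
      (ContinuousAt.comp (f := Prod.snd) (e.continuousAt_symm hq) continuousAt_snd)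
  exact ContinuousAt.comp (f := fun r : P × Model n => (r.1, e.symm r.2))
    (continuous_symm_uncurry (F := fun p => (φ p).toEquiv) hφ).continuousAt hsymm

theorem continuousAt_prod_chart_preimagePoint (h : IsMatchingFamily w₀ w φ) (hq : q.2 ∈ e.target)
    (hx : preimagePoint φ e q ∈ e'.source) :
    ContinuousAt (fun r : P × Model n => (r.1, e' (preimagePoint φ e r))) q :=
  continuousAt_fst.prodMk (ContinuousAt.comp (f := preimagePoint φ e)
    (e'.continuousAt hx) (h.continuousAt_preimagePoint hq))

theorem eventually_preimagePoint_mem_source (h : IsMatchingFamily w₀ w φ) (hq : q.2 ∈ e.target)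
    (hx : preimagePoint φ e q ∈ e'.source) :
    ∀ᶠ r in 𝓝 q, r.2 ∈ e.target ∧ preimagePoint φ e r ∈ e'.source :=
  (continuousAt_snd.eventually (e.open_target.mem_nhds hq)).and
    ((h.continuousAt_preimagePoint hq).eventually (e'.open_source.mem_nhds hx))

variable [IsManifold (𝓡 (2 * n)) ∞ M]

theorem continuousAt_component_pushforward (h : IsMatchingFamily w₀ w φ) (hw : Continuous w)
    (he : e ∈ charts n M) (j k : Fin (2 * n)) (hq : q.2 ∈ e.target) :
    ContinuousAt (fun r : P × Model n =>
      component (pushforward (φ r.1) (w r.1)).toFun e j k r.2) q := by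
  have hx := mem_chart_source (Model n) (preimagePoint φ e q)
  have he' : chartAt (Model n) (preimagePoint φ e q) ∈ charts n M :=
    IsManifold.chart_mem_maximalAtlas _
  set e' := chartAt (Model n) (preimagePoint φ e q)
  have hφx : φ q.1 (preimagePoint φ e q) ∈ e.source := by
    rw [apply_preimagePoint]
    exact e.map_target hq
  refine (ContinuousAt.comp (f := fun r : P × Model n => (r.1, e' (preimagePoint φ e r)))
    (continuousAt_pushforwardComponent hw (h.c1MapFamilyAt _ _) he' he hx hφx j k)
    (h.continuousAt_prod_chart_preimagePoint hq hx)).congr ?_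
  filter_upwards [h.eventually_preimagePoint_mem_source hq hx] with r hr
  exact (component_pushforward_eq_pushforwardComponent φ he' he hr.1 hr.2 j k).symm

theorem exists_component_pushforward_eq_coord_mul (h : IsMatchingFamily w₀ w φ)
    (hw : Continuous w) (hP : ∀ p, (w p).IsPoisson) (hw₀ : w₀.WedgePowTransverse)
    (he : IsAdapted w₀.singularLocus e i) (k : Fin (2 * n)) (hq : q.2 ∈ e.target)
    (hqi : q.2 i = 0) :
    ∃ β : P × Model n → ℝ, ∀ᶠ r in 𝓝 q, ContinuousAt β r ∧
      component (pushforward (φ r.1) (w r.1)).toFun e i k r.2 = r.2 i * β r := by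
  have hx := mem_chart_source (Model n) (preimagePoint φ e q)
  have he' : chartAt (Model n) (preimagePoint φ e q) ∈ charts n M :=
    IsManifold.chart_mem_maximalAtlas _
  set e' := chartAt (Model n) (preimagePoint φ e q)
  have hφq := apply_preimagePoint φ e q
  have hφx : φ q.1 (preimagePoint φ e q) ∈ e.source := by
    rw [hφq]
    exact e.map_target hq
  have hi : e (φ q.1 (preimagePoint φ e q)) i = 0 := by rwa [hφq, e.right_inv hq]
  have hφ := h.c1MapFamilyAt q.1 (preimagePoint φ e q)
  obtain ⟨r, hr, hratio⟩ :=
    (h.isProportionalAt q.1 _).exists_hasWedgePowRatioAt hφ he' he.1 hx hφx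
  obtain ⟨β, hβ⟩ :=
    exists_pushforwardComponent_eq_coord_mul hw hP hw₀ he' he hx hφx hi hφ hr hratio k
  refine ⟨fun s => β (s.1, e' (preimagePoint φ e s)), ?_⟩
  filter_upwards [h.eventually_preimagePoint_mem_source hq hx,
    (h.continuousAt_prod_chart_preimagePoint hq hx).eventually hβ] with s hs hβs
  refine ⟨ContinuousAt.comp (f := fun s : P × Model n => (s.1, e' (preimagePoint φ e s)))
    hβs.1 (h.continuousAt_prod_chart_preimagePoint hs.1 hs.2), ?_⟩
  have hcoord := hβs.2
  simp only [e'.left_inv hs.2, apply_preimagePoint, e.right_inv hs.1] at hcoord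
  rw [← hcoord]
  exact component_pushforward_eq_pushforwardComponent φ he' he.1 hs.1 hs.2 i k

theorem continuousAt_divCoord_component_pushforward (h : IsMatchingFamily w₀ w φ)
    (hw : Continuous w) (hP : ∀ p, (w p).IsPoisson) (hw₀ : w₀.WedgePowTransverse)
    (he : IsAdapted w₀.singularLocus e i) (k : Fin (2 * n)) (hq : q.2 ∈ e.target) :
    ContinuousAt (fun r : P × Model n =>
      divCoord i (component (pushforward (φ r.1) (w r.1)).toFun e i k) r.2) q := by
  by_cases hqi : q.2 i = 0
  · obtain ⟨β, hβ⟩ := h.exists_component_pushforward_eq_coord_mul hw hP hw₀ he k hq hqi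
    refine hβ.self_of_nhds.1.congr ?_
    filter_upwards [hβ, hβ.eventually_nhds] with r hr hr_nhds
    by_cases hri : r.2 i = 0
    · have hslice : ContinuousAt (fun y : Model n => (r.1, y)) r.2 := by fun_prop
      rw [divCoord, if_pos hri]
      exact (fderiv_coord_mul hri
        (ContinuousAt.comp (f := fun y : Model n => (r.1, y)) hr.1 hslice)
        ((hslice.eventually hr_nhds).mono fun y hy => hy.2)).symm
    · rw [divCoord, if_neg hri, hr.2, mul_div_cancel_left₀ _ hri]
  · exact continuousAt_divCoord_of_ne
      (f := fun p => component (pushforward (φ p) (w p)).toFun e i k) hqi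
      (h.continuousAt_component_pushforward hw he.1 i k hq)

theorem continuousAt_bComponent_pushforward (h : IsMatchingFamily w₀ w φ)
    (hw : Continuous w) (hP : ∀ p, (w p).IsPoisson) (hw₀ : w₀.WedgePowTransverse)
    (he : IsAdapted w₀.singularLocus e i) (j k : Fin (2 * n)) (hq : q.2 ∈ e.target) :
    ContinuousAt (fun r : P × Model n =>
      bComponent (pushforward (φ r.1) (w r.1)).toFun e i j k r.2) q := by
  by_cases hj : j = i
  · simp only [bComponent, hj, true_or, if_true]
    exact h.continuousAt_divCoord_component_pushforward hw hP hw₀ he k hq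
  by_cases hk : k = i
  · have hswap (p : P) : component (pushforward (φ p) (w p)).toFun e j i =
        fun y => -component (pushforward (φ p) (w p)).toFun e i j y :=
      funext fun y => component_swap _ e j i y
    simp only [bComponent, hk, or_true, if_true, hswap, divCoord_neg]
    exact (h.continuousAt_divCoord_component_pushforward hw hP hw₀ he j hq).neg
  · simp only [bComponent, hj, hk, or_self, if_false]
    exact h.continuousAt_component_pushforward hw he.1 j k hq

/-- The push-forward of `w p` by `φ p` as a section of `⋀² T_Z M`, where `Z` is the singular locus
of `w₀`. -/
def pushforwardB (h : IsMatchingFamily w₀ w φ) (hw : Continuous w) (hP : ∀ p, (w p).IsPoisson)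
    (hw₀ : w₀.WedgePowTransverse) (p : P) : BBivectorField n w₀.singularLocus where
  toBivectorField := pushforward (φ p) (w p)
  tangent e i he j y hy hyi := by
    obtain ⟨β, hβ⟩ :=
      h.exists_component_pushforward_eq_coord_mul hw hP hw₀ he j (q := (p, y)) hy hyi
    simpa only [hyi, zero_mul] using hβ.self_of_nhds.2

theorem continuous_pushforwardB (h : IsMatchingFamily w₀ w φ) (hw : Continuous w)
    (hP : ∀ p, (w p).IsPoisson) (hw₀ : w₀.WedgePowTransverse) :
    Continuous (h.pushforwardB hw hP hw₀) := by
  refine continuous_iff_coinduced_le.2 (le_inf ?_ ?_)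
  · refine le_iInf₂ fun e he => le_iInf fun _ => le_iInf₂ fun j k =>
      continuous_iff_coinduced_le.1 (continuous_induced_rng.2
        (continuous_ofFun_of_continuousAt fun K hK => ⟨hK.1, fun p y hy => ?_⟩))
    exact h.continuousAt_component_pushforward hw he j k (q := (p, y)) (hK.2 hy)
  · refine le_iInf₂ fun e i => le_iInf fun he => le_iInf₂ fun j k =>
      continuous_iff_coinduced_le.1 (continuous_induced_rng.2
        (continuous_ofFun_of_continuousAt fun K hK => ⟨hK.1, fun p y hy => ?_⟩))
    exact h.continuousAt_bComponent_pushforward hw hP hw₀ he j k (q := (p, y)) (hK.2 hy)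

end IsMatchingFamily

end LogFamily

end LogSymp

end

theorem mainTheorem5 (n : ℕ) {M : Type*} [TopologicalSpace M] [T2Space M] [CompactSpace M]
    [ChartedSpace (LogSymp.Model n) M] [IsManifold (𝓡 (2 * n)) ∞ M]
    (π : LogSymp.Poiss n M) (hπ : π.1.IsLogSymplectic) (Z : Set M)
    (hZ : Z = π.1.singularLocus) :
    ∃ (V : Set (LogSymp.Poiss n M)) (hπV : π ∈ V) (Φ : V → LogSymp.Diff n M)
      (Ψ : V → LogSymp.Log n Z),
      IsOpen V ∧
      (∀ π' : V, π'.1.1.IsLogSymplectic ∧ Φ π' '' π'.1.1.singularLocus = Z) ∧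
      Φ ⟨π, hπV⟩ = Diffeomorph.refl (𝓡 (2 * n)) M ∞ ∧
      (∀ π' : V, LogSymp.IsPushforward (Φ π') π'.1.1 (Ψ π').1.toBivectorField) ∧
      Continuous Ψ := by
  subst hZ
  obtain ⟨V, hπV, φ, hVopen, hφπ, hφ⟩ := LogSymp.exists_isMatchingFamily (p₀ := π)
    continuous_subtype_val hπ.2
  have hcont : Continuous fun π' : V => π'.1.1 :=
    continuous_subtype_val.comp continuous_subtype_val
  have hPoisson : ∀ π' : V, π'.1.1.IsPoisson := fun π' => π'.1.2
  have hlog : ∀ π' : V, π'.1.1.IsLogSymplectic := fun π' =>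
    ⟨hPoisson π', hφ.wedgePowTransverse hπ.2 π'⟩
  exact ⟨V, hπV, φ, fun π' => ⟨hφ.pushforwardB hcont hPoisson hπ.2 π',
      LogSymp.isLogSymplectic_pushforward (φ π') (hlog π'), hφ.singularLocus_pushforward π'⟩,
    hVopen, fun π' => ⟨hlog π', hφ.image_singularLocus π'⟩, hφπ,
    fun π' => LogSymp.isPushforward_pushforward (φ π') π'.1.1,
    (hφ.continuous_pushforwardB hcont hPoisson hπ.2).subtype_mk _⟩
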